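/- For $\theta>0$ and $n\ge 1$ let $R_{\theta,n}$ be the $n\times n$ matrix with $(i,j)$th element $(1+\theta|i-j|/n)\,e^{-\theta|i-j|/n}$, $1\le i,j\le n$. Put $w=\theta/n$, $u=e^{-w}$, and $$\tau_{-1}=(w-1)u+(1+w)u^3,$$ $$\hat\tau_{-2}=2\tau_{-1}u,\qquad \hat\tau_{-1}=(1+w)u-3(1+w)u^3+2(1+2w)u^5,$$ $$\hat\tau_k=(1+kw)u^k-3(1+(k+2)w)u^{k+4}+2(1+(k+3)w)u^{k+6}\quad(k\ge 0),$$ $$\tilde\tau_{-2}=\tfrac12\tau_{-1}u,\qquad \tilde\tau_{-1}=\tfrac12\{(2w-1)u+(1+2w)u^5\},$$ $$\tilde\tau_k=\tfrac12\{2(1+kw)u^k-3(1+(k+1)w)u^{k+2}+(1+(k+3)w)u^{k+6}\}\quad(k\ge 0),$$ $$a=1-2u^2+u^4-2u^2w+2u^4w,\qquad b=2u^2-u^4+w-u^4w-1,$$ $$\tilde a=1-u^2-2u^2w-u^2w^2,\qquad \tilde b=u^2+w+u^2w-1,$$ $$\alpha_{1},\alpha_2=\frac{-(a-2\tau_{-1}u)\mp\sqrt{(a-2\tau_{-1}u)^2-4\tau_{-1}u(b+\tau_{-1}u)}}{2(b+\tau_{-1}u)}$$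 (minus sign for $\alpha_1$, plus sign for $\alpha_2$). For $i=1,2$ let $d_i=(b+\tau_{-1}u)\alpha_i-\tau_{-1}u$, and $$C_{1,i}=\frac{\hat\tau_{-2}\tilde\tau_0[w(2-6u^2+4u^4)+(1-u^2)^2]}{\tau_{-1}u^2d_i}+\frac{w\hat\tau_{-2}\tilde\tau_0(1-u^2)^2}{u\,d_i^2}+\frac{\hat\tau_0\tilde\tau_0-\hat\tau_1\tilde\tau_{-1}}{\tau_{-1}u^4}-\frac{\hat\tau_{-2}\tilde\tau_{-1}[w(3-8u^2+5u^4)+(1-u^2)^2]}{\tau_{-1}u\,d_i}-\frac{w\hat\tau_{-2}\tilde\tau_{-1}(1-u^2)^2}{d_i^2},$$ $$C_{2,i}=\frac{w\hat\tau_{-2}(2-3u^2+u^6)[w(2-6u^2+4u^4)+(1-u^2)^2]}{2\tau_{-1}u^2d_i}+\frac{w^2\hat\tau_{-2}(2-3u^2+u^6)(1-u^2)^2}{2u\,d_i^2}+\frac{w\hat\tau_0(2-3u^2+u^6)}{2\tau_{-1}u^4}-\frac{w(1-u^2)^2\hat\tau_{-2}\tilde\tau_{-1}}{\tau_{-1}u\,d_i}-\frac{w(1-3u^4+2u^6)\tilde\tau_{-1}}{\tau_{-1}u^3},$$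 $$C_{4,i}=\frac{\hat\tau_{-1}\tilde\tau_0}{\tau_{-1}u^4}+\frac{\hat\tau_{-2}\tilde\tau_0[w(1-4u^2+3u^4)+(1-u^2)^2]}{\tau_{-1}u^3d_i}+\frac{w\hat\tau_{-2}\tilde\tau_0(1-u^2)^2}{u^2d_i^2}-\frac{\hat\tau_1\tilde\tau_{-2}}{\tau_{-1}u^4}-\frac{\hat\tau_{-2}\tilde\tau_{-2}[w(3-8u^2+5u^4)+(1-u^2)^2]}{\tau_{-1}u\,d_i}-\frac{w\hat\tau_{-2}\tilde\tau_{-2}(1-u^2)^2}{d_i^2},$$ $$C_{5,i}=\frac{w\hat\tau_{-1}(2-3u^2+u^6)}{2\tau_{-1}u^4}+\frac{w\hat\tau_{-2}(2-3u^2+u^6)[w(1-4u^2+3u^4)+(1-u^2)^2]}{2\tau_{-1}u^3d_i}+\frac{w^2\hat\tau_{-2}(2-3u^2+u^6)(1-u^2)^2}{2u^2d_i^2}-\frac{w\hat\tau_{-2}\tilde\tau_{-2}(1-u^2)^2}{\tau_{-1}u\,d_i}-\frac{w(1-3u^4+2u^6)\tilde\tau_{-2}}{\tau_{-1}u^3},$$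 $$C_{6,i}=\hat\tau_{-1}\tilde\tau_{-1}-\hat\tau_0\tilde\tau_{-2}+\frac{\hat\tau_{-2}u\tilde\tau_{-1}[w(1-4u^2+3u^4)+(1-u^2)^2]}{d_i}-\frac{\hat\tau_{-2}\tilde\tau_{-2}u^2[w(2-6u^2+4u^4)+(1-u^2)^2]}{d_i}+\frac{w\tau_{-1}u^2\hat\tau_{-2}(\tilde\tau_{-1}-u\tilde\tau_{-2})(1-u^2)^2}{d_i^2}.$$ Write $\rho=\alpha_2/\alpha_1$, $\mu_i=-(b+\tau_{-1}u)\alpha_i$, $e_i=\tilde a\alpha_i+u^2\tilde b$, $f_i=a\alpha_i+u^2b$. **Theorem 7.** Let $0<\beta_0<\beta_1<\infty$. As $n\to\infty$, uniformly over $\theta\in[\beta_0,\beta_1]$ and over all $i$ (and $j$) in the indicated ranges, the matrix $R_{\theta,n}$ is invertible for all large $n$, and with $$\epsilon_n=O\Big(\Big(\frac{2-\sqrt3}{2+\sqrt3}\Big)^n\Big)$$ (a relative error that may depend on $\theta,n,i,j$ and differ from line to line, the constant in $O$ depending only on $\beta_0,\beta_1$): 1. for $3\le i\le n-2$, $$(R_{\theta,n}^{-1})_{i,i}=\Big\{\frac{C_{1,1}\tau_{-1}u^4}{\alpha_1-\alpha_2}\Big[\frac{\alpha_1-u^2}{\mu_1^3}-\frac{\alpha_2-u^2}{\mu_1^3}\rho^{n-i-2}\Big]-\frac{C_{1,2}\tau_{-1}u^4e_2}{(\alpha_1-\alpha_2)e_1}\Big[\frac{\alpha_1-u^2}{\mu_2^3}\rho^{i}-\frac{\alpha_2-u^2}{\mu_2^3}\rho^{n-2}\Big]$$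 $$\qquad+\frac{C_{2,1}\tau_{-1}u^6}{\alpha_1-\alpha_2}\Big[\frac1{\mu_1^3}-\frac1{\mu_1^3}\rho^{n-i-2}\Big]-\frac{C_{2,2}\tau_{-1}u^6e_2}{(\alpha_1-\alpha_2)e_1}\Big[\frac1{\mu_2^3}\rho^{i}-\frac1{\mu_2^3}\rho^{n-2}\Big]\Big\}(1+\epsilon_n);$$ 2. for $5\le i+2\le j\le n-1$, $$(R_{\theta,n}^{-1})_{i,j}=\frac1{\tau_{-1}^4(\alpha_1-\alpha_2)}\Big(\frac u{\alpha_1}\Big)^{j-i+2}\Big\{C_{6,1}[f_1-f_2\rho^{n-j-1}]-\frac{C_{6,2}e_2}{e_1}[f_1\rho^{i-3}-f_2\rho^{n-j+i-4}]\Big\}(1+\epsilon_n);$$ 3. for $3\le i\le n-2$, $$(R_{\theta,n}^{-1})_{i,i+1}=-\Big\{\frac{C_{4,1}\tau_{-1}u^4}{\alpha_1-\alpha_2}\Big[\frac{\alpha_1-u^2}{\mu_1^3}-\frac{\alpha_2-u^2}{\mu_1^3}\rho^{n-i-2}\Big]-\frac{C_{4,2}\tau_{-1}u^4e_2}{(\alpha_1-\alpha_2)e_1}\Big[\frac{\alpha_1-u^2}{\mu_2^3}\rho^{i}-\frac{\alpha_2-u^2}{\mu_2^3}\rho^{n-2}\Big]$$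 $$\qquad+\frac{C_{5,1}\tau_{-1}u^6}{\alpha_1-\alpha_2}\Big[\frac1{\mu_1^3}-\frac1{\mu_1^3}\rho^{n-i-2}\Big]-\frac{C_{5,2}\tau_{-1}u^6e_2}{(\alpha_1-\alpha_2)e_1}\Big[\frac1{\mu_2^3}\rho^{i}-\frac1{\mu_2^3}\rho^{n-2}\Big]\Big\}(1+\epsilon_n);$$ 4. for $3\le i\le n-2$, $$(R_{\theta,n}^{-1})_{i,n}=\Big\{\frac{C_{6,1}}{\mu_1^3}\Big(\frac u{\alpha_1}\Big)^{n-i-2}-\frac{C_{6,2}e_2}{e_1\mu_2^3}\Big(\frac u{\alpha_1}\Big)^{n-i-2}\rho^{i}\Big\}(1+\epsilon_n).$$ -/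

import Mathlib

noncomputable section

namespace MaternInverse

/-- The `n × n` correlation matrix `R_{θ,n}` with entries
`(1 + θ|i-j|/n) exp(-θ|i-j|/n)`. The rows and columns `1, …, n` are stored as `0, …, n-1`,
which does not change `|i-j|`. -/
def R (θ : ℝ) (n : ℕ) : Matrix (Fin n) (Fin n) ℝ :=
  Matrix.of fun i j =>
    (1 + θ * |(i : ℝ) - (j : ℝ)| / n) * Real.exp (-(θ * |(i : ℝ) - (j : ℝ)| / n))

/-! All quantities below are functions of `w = θ/n`. -/

/-- `u = e^{-w}`. -/
def u (w : ℝ) : ℝ := Real.exp (-w)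

/-- `τ_{-1}`. -/
def tauNegOne (w : ℝ) : ℝ := (w - 1) * u w + (1 + w) * u w ^ 3

/-- `τ̂_k`, `k ≥ -2` (and `0` for the indices `k < -2`, which never occur). -/
def tauHat (k : ℤ) (w : ℝ) : ℝ :=
  match k with
  | Int.ofNat k =>
      (1 + k * w) * u w ^ k - 3 * (1 + (k + 2) * w) * u w ^ (k + 4)
        + 2 * (1 + (k + 3) * w) * u w ^ (k + 6)
  | Int.negSucc 0 => (1 + w) * u w - 3 * (1 + w) * u w ^ 3 + 2 * (1 + 2 * w) * u w ^ 5
  | Int.negSucc 1 => 2 * tauNegOne w * u w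
  | Int.negSucc _ => 0

/-- `τ̃_k`, `k ≥ -2` (and `0` for the indices `k < -2`, which never occur). -/
def tauTilde (k : ℤ) (w : ℝ) : ℝ :=
  match k with
  | Int.ofNat k =>
      (2 * (1 + k * w) * u w ^ k - 3 * (1 + (k + 1) * w) * u w ^ (k + 2)
        + (1 + (k + 3) * w) * u w ^ (k + 6)) / 2
  | Int.negSucc 0 => ((2 * w - 1) * u w + (1 + 2 * w) * u w ^ 5) / 2
  | Int.negSucc 1 => tauNegOne w * u w / 2
  | Int.negSucc _ => 0

def a (w : ℝ) : ℝ := 1 - 2 * u w ^ 2 + u w ^ 4 - 2 * u w ^ 2 * w + 2 * u w ^ 4 * w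

def b (w : ℝ) : ℝ := 2 * u w ^ 2 - u w ^ 4 + w - u w ^ 4 * w - 1

/-- `ã`. -/
def aTilde (w : ℝ) : ℝ := 1 - u w ^ 2 - 2 * u w ^ 2 * w - u w ^ 2 * w ^ 2

/-- `b̃`. -/
def bTilde (w : ℝ) : ℝ := u w ^ 2 + w + u w ^ 2 * w - 1

/-- `b + τ_{-1} u`. -/
def lead (w : ℝ) : ℝ := b w + tauNegOne w * u w

/-- The discriminant `(a - 2τ_{-1}u)² - 4τ_{-1}u(b + τ_{-1}u)`. -/
def disc (w : ℝ) : ℝ :=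
  (a w - 2 * tauNegOne w * u w) ^ 2 - 4 * tauNegOne w * u w * (b w + tauNegOne w * u w)

/-- `α₁`. -/
def alpha1 (w : ℝ) : ℝ :=
  (-(a w - 2 * tauNegOne w * u w) - Real.sqrt (disc w)) / (2 * (b w + tauNegOne w * u w))

/-- `α₂`. -/
def alpha2 (w : ℝ) : ℝ :=
  (-(a w - 2 * tauNegOne w * u w) + Real.sqrt (disc w)) / (2 * (b w + tauNegOne w * u w))

/-- `(b + τ_{-1}u)α - τ_{-1}u`, the denominator occurring in the constants `C_{k,i}`. -/
def den (w α : ℝ) : ℝ := (b w + tauNegOne w * u w) * α - tauNegOne w * u w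

/-! The constants `C_{k,i}`, `i = 1, 2`, are `Ck w α` at `α = α_i`. -/

def C1 (w α : ℝ) : ℝ :=
  tauHat (-2) w * tauTilde 0 w * (w * (2 - 6 * u w ^ 2 + 4 * u w ^ 4) + (1 - u w ^ 2) ^ 2)
      / (tauNegOne w * u w ^ 2 * den w α)
    + w * tauHat (-2) w * tauTilde 0 w * (1 - u w ^ 2) ^ 2 / (u w * den w α ^ 2)
    + (tauHat 0 w * tauTilde 0 w - tauHat 1 w * tauTilde (-1) w) / (tauNegOne w * u w ^ 4)
    - tauHat (-2) w * tauTilde (-1) w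
        * (w * (3 - 8 * u w ^ 2 + 5 * u w ^ 4) + (1 - u w ^ 2) ^ 2)
      / (tauNegOne w * u w * den w α)
    - w * tauHat (-2) w * tauTilde (-1) w * (1 - u w ^ 2) ^ 2 / den w α ^ 2

def C2 (w α : ℝ) : ℝ :=
  w * tauHat (-2) w * (2 - 3 * u w ^ 2 + u w ^ 6)
        * (w * (2 - 6 * u w ^ 2 + 4 * u w ^ 4) + (1 - u w ^ 2) ^ 2)
      / (2 * tauNegOne w * u w ^ 2 * den w α)
    + w ^ 2 * tauHat (-2) w * (2 - 3 * u w ^ 2 + u w ^ 6) * (1 - u w ^ 2) ^ 2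
      / (2 * u w * den w α ^ 2)
    + w * tauHat 0 w * (2 - 3 * u w ^ 2 + u w ^ 6) / (2 * tauNegOne w * u w ^ 4)
    - w * (1 - u w ^ 2) ^ 2 * tauHat (-2) w * tauTilde (-1) w
      / (tauNegOne w * u w * den w α)
    - w * (1 - 3 * u w ^ 4 + 2 * u w ^ 6) * tauTilde (-1) w / (tauNegOne w * u w ^ 3)

def C4 (w α : ℝ) : ℝ :=
  tauHat (-1) w * tauTilde 0 w / (tauNegOne w * u w ^ 4)
    + tauHat (-2) w * tauTilde 0 w
        * (w * (1 - 4 * u w ^ 2 + 3 * u w ^ 4) + (1 - u w ^ 2) ^ 2)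
      / (tauNegOne w * u w ^ 3 * den w α)
    + w * tauNegOne w * tauHat (-2) w * tauTilde 0 w * (1 - u w ^ 2) ^ 2
      / (tauNegOne w * u w ^ 2 * den w α ^ 2)
    - tauHat 1 w * tauTilde (-2) w / (tauNegOne w * u w ^ 4)
    - tauHat (-2) w * tauTilde (-2) w
        * (w * (3 - 8 * u w ^ 2 + 5 * u w ^ 4) + (1 - u w ^ 2) ^ 2)
      / (tauNegOne w * u w * den w α)
    - w * tauHat (-2) w * tauTilde (-2) w * (1 - u w ^ 2) ^ 2 / den w α ^ 2

def C5 (w α : ℝ) : ℝ :=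
  w * tauHat (-1) w * (2 - 3 * u w ^ 2 + u w ^ 6) / (2 * tauNegOne w * u w ^ 4)
    + w * tauHat (-2) w * (2 - 3 * u w ^ 2 + u w ^ 6)
        * (w * (1 - 4 * u w ^ 2 + 3 * u w ^ 4) + (1 - u w ^ 2) ^ 2)
      / (2 * tauNegOne w * u w ^ 3 * den w α)
    + w ^ 2 * tauHat (-2) w * (2 - 3 * u w ^ 2 + u w ^ 6) * (1 - u w ^ 2) ^ 2
      / (2 * u w ^ 2 * den w α ^ 2)
    - w * tauHat (-2) w * tauTilde (-2) w * (1 - u w ^ 2) ^ 2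
      / (tauNegOne w * u w * den w α)
    - w * (1 - 3 * u w ^ 4 + 2 * u w ^ 6) * tauTilde (-2) w / (tauNegOne w * u w ^ 3)

def C6 (w α : ℝ) : ℝ :=
  tauHat (-1) w * tauTilde (-1) w - tauHat 0 w * tauTilde (-2) w
    + tauHat (-2) w * u w * tauTilde (-1) w
        * (w * (1 - 4 * u w ^ 2 + 3 * u w ^ 4) + (1 - u w ^ 2) ^ 2) / den w α
    - tauHat (-2) w * tauTilde (-2) w * u w ^ 2
        * (w * (2 - 6 * u w ^ 2 + 4 * u w ^ 4) + (1 - u w ^ 2) ^ 2) / den w α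
    + w * tauNegOne w * u w ^ 2 * tauHat (-2) w * (tauTilde (-1) w - u w * tauTilde (-2) w)
        * (1 - u w ^ 2) ^ 2 / den w α ^ 2

/-- `ãα + u²b̃`. -/
def edge (w α : ℝ) : ℝ := aTilde w * α + u w ^ 2 * bTilde w

/-- `aα + u²b`. -/
def tail (w α : ℝ) : ℝ := a w * α + u w ^ 2 * b w

/-! The approximating expressions. Indices `i`, `j` are the usual ones, counted from `1`.
The natural-number subtractions in the exponents do not truncate for `3 ≤ i ≤ n - 2`,
respectively for `5 ≤ i + 2 ≤ j ≤ n - 1`. -/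

/-- Approximation to the `(i,i)` entry. -/
def diagApprox (w : ℝ) (n i : ℕ) : ℝ :=
  C1 w (alpha1 w) * tauNegOne w * u w ^ 4 / (alpha1 w - alpha2 w)
      * ((alpha1 w - u w ^ 2) / (-lead w * alpha1 w) ^ 3
        - (alpha2 w - u w ^ 2) / (-lead w * alpha1 w) ^ 3
            * (alpha2 w / alpha1 w) ^ (n - i - 2))
    - C1 w (alpha2 w) * tauNegOne w * u w ^ 4 * edge w (alpha2 w)
        / ((alpha1 w - alpha2 w) * edge w (alpha1 w))
      * ((alpha1 w - u w ^ 2) / (-lead w * alpha2 w) ^ 3 * (alpha2 w / alpha1 w) ^ i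
        - (alpha2 w - u w ^ 2) / (-lead w * alpha2 w) ^ 3 * (alpha2 w / alpha1 w) ^ (n - 2))
    + C2 w (alpha1 w) * tauNegOne w * u w ^ 6 / (alpha1 w - alpha2 w)
      * (1 / (-lead w * alpha1 w) ^ 3
        - 1 / (-lead w * alpha1 w) ^ 3 * (alpha2 w / alpha1 w) ^ (n - i - 2))
    - C2 w (alpha2 w) * tauNegOne w * u w ^ 6 * edge w (alpha2 w)
        / ((alpha1 w - alpha2 w) * edge w (alpha1 w))
      * (1 / (-lead w * alpha2 w) ^ 3 * (alpha2 w / alpha1 w) ^ i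
        - 1 / (-lead w * alpha2 w) ^ 3 * (alpha2 w / alpha1 w) ^ (n - 2))

/-- Approximation to the `(i,i+1)` entry. -/
def superdiagApprox (w : ℝ) (n i : ℕ) : ℝ :=
  -(C4 w (alpha1 w) * tauNegOne w * u w ^ 4 / (alpha1 w - alpha2 w)
      * ((alpha1 w - u w ^ 2) / (-lead w * alpha1 w) ^ 3
        - (alpha2 w - u w ^ 2) / (-lead w * alpha1 w) ^ 3
            * (alpha2 w / alpha1 w) ^ (n - i - 2))
    - C4 w (alpha2 w) * tauNegOne w * u w ^ 4 * edge w (alpha2 w)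
        / ((alpha1 w - alpha2 w) * edge w (alpha1 w))
      * ((alpha1 w - u w ^ 2) / (-lead w * alpha2 w) ^ 3 * (alpha2 w / alpha1 w) ^ i
        - (alpha2 w - u w ^ 2) / (-lead w * alpha2 w) ^ 3 * (alpha2 w / alpha1 w) ^ (n - 2))
    + C5 w (alpha1 w) * tauNegOne w * u w ^ 6 / (alpha1 w - alpha2 w)
      * (1 / (-lead w * alpha1 w) ^ 3
        - 1 / (-lead w * alpha1 w) ^ 3 * (alpha2 w / alpha1 w) ^ (n - i - 2))
    - C5 w (alpha2 w) * tauNegOne w * u w ^ 6 * edge w (alpha2 w)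
        / ((alpha1 w - alpha2 w) * edge w (alpha1 w))
      * (1 / (-lead w * alpha2 w) ^ 3 * (alpha2 w / alpha1 w) ^ i
        - 1 / (-lead w * alpha2 w) ^ 3 * (alpha2 w / alpha1 w) ^ (n - 2)))

/-- Approximation to the `(i,j)` entry, `5 ≤ i + 2 ≤ j ≤ n - 1`. -/
def offdiagApprox (w : ℝ) (n i j : ℕ) : ℝ :=
  1 / (tauNegOne w ^ 4 * (alpha1 w - alpha2 w)) * (u w / alpha1 w) ^ (j - i + 2)
    * (C6 w (alpha1 w)
        * (tail w (alpha1 w) - tail w (alpha2 w) * (alpha2 w / alpha1 w) ^ (n - j - 1))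
      - C6 w (alpha2 w) * edge w (alpha2 w) / edge w (alpha1 w)
        * (tail w (alpha1 w) * (alpha2 w / alpha1 w) ^ (i - 3)
          - tail w (alpha2 w) * (alpha2 w / alpha1 w) ^ (n - j + i - 4)))

/-- Approximation to the `(i,n)` entry. -/
def lastColApprox (w : ℝ) (n i : ℕ) : ℝ :=
  C6 w (alpha1 w) / (-lead w * alpha1 w) ^ 3 * (u w / alpha1 w) ^ (n - i - 2)
    - C6 w (alpha2 w) * edge w (alpha2 w)
        / (edge w (alpha1 w) * (-lead w * alpha2 w) ^ 3)
      * (u w / alpha1 w) ^ (n - i - 2) * (alpha2 w / alpha1 w) ^ i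

/-- `x = y (1 + ε)` with `|ε| ≤ δ`. -/
def RelApprox (x y δ : ℝ) : Prop := ∃ ε : ℝ, |ε| ≤ δ ∧ x = y * (1 + ε)

/-- `(2 - √3)/(2 + √3)`. -/
def rate : ℝ := (2 - Real.sqrt 3) / (2 + Real.sqrt 3)

end MaternInverse

end

namespace MaternInverse

/-! Away from lag 0 the covariance `(1 + |m| w) u^|m|` is killed by the symmetric fourth-order
difference D with symbol `(1 - u z)² (z - u)²`. So D turns the covariance matrix into a tridiagonal
Toeplitz one with coefficients `tauNegOne w`, `mid w`, `tauNegOne w`, whose characteristic roots are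
γ and γ⁻¹, where `α₁ = u / γ` and `α₂ = u γ`. An interior row of the inverse solves this recurrence
with source D applied to a unit vector. Dividing the symbol of D by the tridiagonal one gives a
quotient, which is a correction on the diagonal and its two neighbours, and a constant remainder,
which produces a Green's function decaying like γ^d and reflected at both ends with coefficient
`refl`. The resulting vector is `row`, and `conv_row` verifies it.

The error is then explicit: each approximation is the exact entry times `1 - κ`, where `κ = refl²
γ^(2(n-1))` is the weight of a round trip between the ends. The inequality `4 τ₋₁ < mid` forces `γ ≥
-(2 - √3)`, and `refl ≤ 1`, so `κ ≤ rate^(n-1)` for every θ > 0.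

To match `row` with the constants `C_k`, note that the characteristic equation is linear in w once u
and γ are fixed. Everything becomes a rational function of the independent variables u and γ, and
the identities are checked by field arithmetic. -/

/-! ### Hyperbolic inequalities and the tridiagonal coefficients. -/

theorem u_pos (w : ℝ) : 0 < u w := Real.exp_pos _

theorem u_lt_one {w : ℝ} (hw : 0 < w) : u w < 1 := by
  unfold u; simpa using hw

theorem sinh_lt_mul_cosh {w : ℝ} (hw : 0 < w) : Real.sinh w < w * Real.cosh w := by
  have h : StrictMonoOn (fun x : ℝ => x * Real.cosh x - Real.sinh x) (Set.Ici 0) := by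
    apply strictMonoOn_of_deriv_pos (convex_Ici 0) (by fun_prop)
    intro x hx
    rw [interior_Ici, Set.mem_Ioi] at hx
    have hd : HasDerivAt (fun x : ℝ => x * Real.cosh x - Real.sinh x)
        (1 * Real.cosh x + x * Real.sinh x - Real.cosh x) x :=
      ((hasDerivAt_id x).mul (Real.hasDerivAt_cosh x)).sub (Real.hasDerivAt_sinh x)
    rw [hd.deriv]
    nlinarith [mul_pos hx (Real.sinh_pos_iff.2 hx)]
  have := h Set.self_mem_Ici hw.le hw
  simp at this
  linarith

/-- This is `4 τ₋₁ < mid` divided by `4 u²`. The difference of the two sides vanishes at 0 and has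
derivative `2 sinh x (sinh x - x)`. -/
theorem add_two_mul_mul_cosh_lt {w : ℝ} (hw : 0 < w) :
    w + 2 * (w * Real.cosh w) < Real.sinh w * Real.cosh w + 2 * Real.sinh w := by
  have h : StrictMonoOn (fun x : ℝ => Real.sinh x * Real.cosh x + 2 * Real.sinh x
      - (x + 2 * (x * Real.cosh x))) (Set.Ici 0) := by
    apply strictMonoOn_of_deriv_pos (convex_Ici 0) (by fun_prop)
    intro x hx
    rw [interior_Ici, Set.mem_Ioi] at hx
    have hd : HasDerivAt (fun x : ℝ => Real.sinh x * Real.cosh x + 2 * Real.sinh x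
        - (x + 2 * (x * Real.cosh x)))
        (Real.cosh x * Real.cosh x + Real.sinh x * Real.sinh x + 2 * Real.cosh x
          - (1 + 2 * (1 * Real.cosh x + x * Real.sinh x))) x :=
      (((Real.hasDerivAt_sinh x).mul (Real.hasDerivAt_cosh x)).add
        ((Real.hasDerivAt_sinh x).const_mul 2)).sub
        ((hasDerivAt_id x).add
          (((hasDerivAt_id x).mul (Real.hasDerivAt_cosh x)).const_mul 2))
    rw [hd.deriv]
    have h1 := Real.cosh_sq x
    have h2 := mul_pos (Real.sinh_pos_iff.2 hx) (sub_pos.2 (Real.self_lt_sinh_iff.2 hx))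
    nlinarith
  have := h Set.self_mem_Ici hw.le hw
  simp at this
  linarith

/-- The diagonal coefficient of the tridiagonal symbol whose off-diagonal coefficient is
`tauNegOne w`. -/
noncomputable def mid (w : ℝ) : ℝ := 1 - 4 * w * u w ^ 2 - u w ^ 4

theorem tauNegOne_eq (w : ℝ) :
    tauNegOne w = 2 * u w ^ 2 * (w * Real.cosh w - Real.sinh w) := by
  have h : Real.exp w = (u w)⁻¹ := by rw [u, ← Real.exp_neg, neg_neg]
  have hu := (u_pos w).ne'
  rw [Real.cosh_eq, Real.sinh_eq, tauNegOne, h, show Real.exp (-w) = u w from rfl]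
  field_simp
  ring

theorem mid_eq (w : ℝ) :
    mid w = 4 * u w ^ 2 * (Real.sinh w * Real.cosh w - w) := by
  have h : Real.exp w = (u w)⁻¹ := by rw [u, ← Real.exp_neg, neg_neg]
  have hu := (u_pos w).ne'
  rw [Real.cosh_eq, Real.sinh_eq, mid, h, show Real.exp (-w) = u w from rfl]
  field_simp
  ring

theorem tauNegOne_pos {w : ℝ} (hw : 0 < w) : 0 < tauNegOne w := by
  rw [tauNegOne_eq]
  have := u_pos w
  have := sub_pos.2 (sinh_lt_mul_cosh hw)
  positivity

theorem four_mul_tauNegOne_lt_mid {w : ℝ} (hw : 0 < w) : 4 * tauNegOne w < mid w := by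
  rw [tauNegOne_eq, mid_eq]
  have h := add_two_mul_mul_cosh_lt hw
  have := u_pos w
  have : 0 < 4 * u w ^ 2 * ((Real.sinh w * Real.cosh w + 2 * Real.sinh w)
      - (w + 2 * (w * Real.cosh w))) := mul_pos (by positivity) (sub_pos.2 h)
  linarith

/-- With this, substituting `α = u z` makes the quadratic for α palindromic: `τ₋₁ (z² + 1) + mid z =
0`. -/
theorem lead_eq (w : ℝ) : lead w = tauNegOne w / u w := by
  have hu := (u_pos w).ne'
  unfold lead b tauNegOne
  field_simp
  ring

theorem a_sub_eq_mid (w : ℝ) : a w - 2 * tauNegOne w * u w = mid w := by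
  unfold a tauNegOne mid; ring

theorem rate_eq : rate = (2 - Real.sqrt 3) ^ 2 := by
  have h : Real.sqrt 3 ^ 2 = 3 := Real.sq_sqrt (by norm_num)
  have : 0 < 2 + Real.sqrt 3 := by positivity
  rw [rate, div_eq_iff this.ne']
  linear_combination (2 - Real.sqrt 3) * h

theorem rate_pos : 0 < rate := by
  have h : Real.sqrt 3 < 2 := by
    rw [Real.sqrt_lt' (by norm_num)]; norm_num
  rw [rate_eq]
  exact pow_pos (sub_pos.2 h) 2

theorem rate_lt : rate < 1 / 4 := by
  have h : (3 : ℝ) / 2 < Real.sqrt 3 := Real.lt_sqrt_of_sq_lt (by norm_num)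
  have h2 : Real.sqrt 3 < 2 := by
    rw [Real.sqrt_lt' (by norm_num)]; norm_num
  rw [rate_eq]
  nlinarith

/-! ### The characteristic root and the rational parametrization. -/

/-- The common denominator of the rational parametrization of all quantities by `u` and the
characteristic root `z = α / u`. -/
noncomputable def quad (U z : ℝ) : ℝ := (z - U) ^ 2 + (1 - U * z) ^ 2

/-- `w` as a function of `u` and of the characteristic root. -/
noncomputable def wOf (U z : ℝ) : ℝ := (1 - U ^ 2) * (1 - U * z) * (U - z) / (U * quad U z)

theorem quad_pos {U z : ℝ} (hU : 0 < U) (hz : z < 0) : 0 < quad U z := by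
  unfold quad
  have : 0 < (z - U) ^ 2 := by
    apply sq_pos_of_neg; linarith
  positivity

theorem exists_root {w : ℝ} (hw : 0 < w) :
    ∃ γ : ℝ, -1 < γ ∧ γ < 0 ∧ γ ^ 2 ≤ rate ∧ alpha1 w = u w / γ ∧ alpha2 w = u w * γ ∧
      tauNegOne w * (γ ^ 2 + 1) + mid w * γ = 0 ∧ w = wOf (u w) γ := by
  have hτ := tauNegOne_pos hw
  have hm := four_mul_tauNegOne_lt_mid hw
  have hu := u_pos w
  have hdisc : disc w = mid w ^ 2 - 4 * tauNegOne w ^ 2 := by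
    have h1 := lead_eq w
    unfold lead at h1
    unfold disc
    rw [h1, a_sub_eq_mid]
    field_simp
  have hdpos : 0 < disc w := by rw [hdisc]; nlinarith
  set s := Real.sqrt (disc w) with hs
  have hs0 : 0 < s := Real.sqrt_pos.2 hdpos
  have hs2 : s ^ 2 = mid w ^ 2 - 4 * tauNegOne w ^ 2 := by
    rw [← hdisc]; exact Real.sq_sqrt hdpos.le
  have hslt : s < mid w := by nlinarith
  have hsgt : mid w - 2 * tauNegOne w < s := by
    by_contra hc
    push Not at hc
    nlinarith
  have h1 := lead_eq w
  unfold lead at h1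
  have hquad : tauNegOne w * (((-mid w + s) / (2 * tauNegOne w)) ^ 2 + 1)
      + mid w * ((-mid w + s) / (2 * tauNegOne w)) = 0 := by
    field_simp
    linear_combination hs2
  have hneg : (-mid w + s) / (2 * tauNegOne w) < 0 :=
    div_neg_of_neg_of_pos (by linarith) (by linarith)
  have hgt : -1 < (-mid w + s) / (2 * tauNegOne w) := by
    rw [lt_div_iff₀ (by linarith)]; linarith
  have ha2 : alpha2 w = u w * ((-mid w + s) / (2 * tauNegOne w)) := by
    unfold alpha2
    rw [h1, a_sub_eq_mid, ← hs]
    field_simp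
  have ha1 : alpha1 w = u w / ((-mid w + s) / (2 * tauNegOne w)) := by
    unfold alpha1
    rw [h1, a_sub_eq_mid, ← hs]
    have : -mid w + s ≠ 0 := by linarith
    field_simp
    linear_combination -hs2
  generalize (-mid w + s) / (2 * tauNegOne w) = γ at *
  refine ⟨γ, hgt, hneg, ?_, ha1, ha2, hquad, ?_⟩
  -- Since `mid > 4 τ₋₁` and γ < 0, the characteristic equation gives `γ² + 4γ + 1 ≥ 0`; as γ > -1,
  -- it lies to the right of the root `-2 + √3`.
  · have h3 : Real.sqrt 3 ^ 2 = 3 := Real.sq_sqrt (by norm_num)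
    have hγ : 0 ≤ γ ^ 2 + 4 * γ + 1 := by
      have : 0 ≤ tauNegOne w * (γ ^ 2 + 4 * γ + 1) := by nlinarith
      exact nonneg_of_mul_nonneg_right this hτ
    have h4 : Real.sqrt 3 ≤ 2 + γ := by
      apply Real.sqrt_le_iff.2
      constructor <;> nlinarith
    rw [rate_eq]
    nlinarith
  -- The characteristic equation, linear in w, solved for w.
  · have hq := quad_pos hu hneg
    rw [wOf, eq_div_iff (by positivity), quad]
    unfold tauNegOne mid at hquad
    linear_combination hquad

section Parametrization

variable {w z : ℝ}

/-- Once `u w` is generalized and w substituted, u and z are independent and the relation `u = exp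
(-w)` plays no role. Here z may be either root, which covers α₁ and α₂ at once. -/
theorem tauNegOne_param (hw : w = wOf (u w) z) (hq : quad (u w) z ≠ 0) :
    tauNegOne w = -(1 - u w ^ 2) ^ 3 * z / quad (u w) z := by
  have hu := (u_pos w).ne'
  unfold tauNegOne
  generalize u w = U at *
  subst hw
  unfold wOf
  field_simp
  unfold quad
  ring

theorem lead_param (hw : w = wOf (u w) z) (hq : quad (u w) z ≠ 0) :
    lead w = -(1 - u w ^ 2) ^ 3 * z / (u w * quad (u w) z) := by
  have hu := (u_pos w).ne'
  rw [lead_eq, tauNegOne_param hw hq]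
  field_simp

theorem mid_param (hw : w = wOf (u w) z) (hq : quad (u w) z ≠ 0) :
    mid w = (1 - u w ^ 2) ^ 3 * (z ^ 2 + 1) / quad (u w) z := by
  have hu := (u_pos w).ne'
  unfold mid
  generalize u w = U at *
  subst hw
  unfold wOf
  field_simp
  unfold quad
  ring

theorem tail_param (hw : w = wOf (u w) z) (hq : quad (u w) z ≠ 0) :
    tail w (u w * z) = u w * (1 - u w ^ 2) ^ 3 * z * (z - u w) ^ 2 / quad (u w) z := by
  have hu := (u_pos w).ne'
  unfold tail a b
  generalize u w = U at *
  subst hw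
  unfold wOf
  field_simp
  unfold quad
  ring

theorem edge_param (hw : w = wOf (u w) z) (hq : quad (u w) z ≠ 0) :
    edge w (u w * z) = u w * (1 - u w ^ 2) ^ 2 * z * (z - u w) ^ 4 / quad (u w) z ^ 2 := by
  have hu := (u_pos w).ne'
  unfold edge aTilde bTilde
  generalize u w = U at *
  subst hw
  unfold wOf
  field_simp
  unfold quad
  ring

theorem den_param (hw : w = wOf (u w) z) (hq : quad (u w) z ≠ 0) :
    den w (u w * z) = -(1 - u w ^ 2) ^ 3 * z * (z - u w) / quad (u w) z := by
  have hu := (u_pos w).ne'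
  have h := lead_param hw hq
  unfold lead at h
  unfold den
  rw [h, tauNegOne_param hw hq]
  field_simp
  ring

theorem tauHat_neg_two (w : ℝ) : tauHat (-2) w = 2 * tauNegOne w * u w := rfl

theorem tauHat_neg_one (w : ℝ) :
    tauHat (-1) w = (1 + w) * u w - 3 * (1 + w) * u w ^ 3 + 2 * (1 + 2 * w) * u w ^ 5 := rfl

theorem tauHat_zero (w : ℝ) :
    tauHat 0 w = 1 - 3 * (1 + 2 * w) * u w ^ 4 + 2 * (1 + 3 * w) * u w ^ 6 := by
  simp [tauHat]

theorem tauHat_one (w : ℝ) :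
    tauHat 1 w = (1 + w) * u w - 3 * (1 + 3 * w) * u w ^ 5 + 2 * (1 + 4 * w) * u w ^ 7 := by
  change (1 + ((1 : ℕ) : ℝ) * w) * u w ^ 1 - 3 * (1 + (((1 : ℕ) : ℝ) + 2) * w) * u w ^ (1 + 4)
        + 2 * (1 + (((1 : ℕ) : ℝ) + 3) * w) * u w ^ (1 + 6) = _
  push_cast
  ring

theorem tauTilde_neg_two (w : ℝ) : tauTilde (-2) w = tauNegOne w * u w / 2 := rfl

theorem tauTilde_neg_one (w : ℝ) :
    tauTilde (-1) w = ((2 * w - 1) * u w + (1 + 2 * w) * u w ^ 5) / 2 := rfl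

theorem tauTilde_zero (w : ℝ) :
    tauTilde 0 w = (2 - 3 * (1 + w) * u w ^ 2 + (1 + 3 * w) * u w ^ 6) / 2 := by
  simp [tauTilde]

theorem C6_param (hw : w = wOf (u w) z) (hq : quad (u w) z ≠ 0) (_ : 1 - u w ^ 2 ≠ 0)
    (_ : z ≠ 0) (_ : z - u w ≠ 0) :
    C6 w (u w * z) = (1 - u w ^ 2) ^ 6 * z ^ 2 * (1 - u w * z) ^ 2 / quad (u w) z ^ 2 := by
  have hu := (u_pos w).ne'
  unfold C6
  rw [den_param hw hq, tauHat_neg_two, tauHat_neg_one, tauHat_zero, tauTilde_neg_two,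
    tauTilde_neg_one, tauNegOne_param hw hq]
  generalize u w = U at *
  subst hw
  unfold wOf
  field_simp
  unfold quad
  ring

/-- The diagonal formula involves `C1` and `C2` only through this combination, where the factor `α -
u²` uses either the root at which the constants are evaluated, as here, or the other root, as in
`C1_add_C2_inv`. -/
theorem C1_add_C2_self (hw : w = wOf (u w) z) (hq : quad (u w) z ≠ 0)
    (_ : 1 - u w ^ 2 ≠ 0) (_ : z ≠ 0) (_ : z - u w ≠ 0) :
    C1 w (u w * z) * (u w * z - u w ^ 2) + u w ^ 2 * C2 w (u w * z)
      = z / u w ^ 3 * ((1 - u w * z) ^ 2 * (z - u w) ^ 2 * tauNegOne w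
        + z * (z ^ 2 - 1) * (2 * u w * (1 + u w ^ 2) * tauNegOne w + u w ^ 2 * mid w)) := by
  have hu := (u_pos w).ne'
  have hτ := tauNegOne_param hw hq
  unfold C1 C2
  rw [den_param hw hq, tauHat_neg_two, tauHat_zero, tauHat_one,
    tauTilde_zero, tauTilde_neg_one, hτ, mid_param hw hq]
  clear hτ
  generalize u w = U at *
  subst hw
  unfold wOf
  field_simp
  unfold quad
  ring

theorem C1_add_C2_inv (hw : w = wOf (u w) z) (hq : quad (u w) z ≠ 0)
    (_ : 1 - u w ^ 2 ≠ 0) (_ : z ≠ 0) (_ : z - u w ≠ 0) :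
    C1 w (u w * z) * (u w / z - u w ^ 2) + u w ^ 2 * C2 w (u w * z)
      = tauNegOne w * (1 - u w * z) ^ 4 / (u w ^ 3 * z ^ 3) := by
  have hu := (u_pos w).ne'
  have hτ := tauNegOne_param hw hq
  unfold C1 C2
  rw [den_param hw hq, tauHat_neg_two, tauHat_zero, tauHat_one,
    tauTilde_zero, tauTilde_neg_one, hτ]
  clear hτ
  generalize u w = U at *
  subst hw
  unfold wOf
  field_simp
  unfold quad
  ring

theorem C4_add_C5_self (hw : w = wOf (u w) z) (hq : quad (u w) z ≠ 0)
    (_ : 1 - u w ^ 2 ≠ 0) (_ : z ≠ 0) (_ : z - u w ≠ 0) :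
    C4 w (u w * z) * (u w * z - u w ^ 2) + u w ^ 2 * C5 w (u w * z)
      = tauNegOne w / u w ^ 3 *
        (-((1 - u w * z) ^ 2 * (z - u w) ^ 2) + u w ^ 2 * z ^ 2 * (z ^ 2 - 1)) := by
  have hu := (u_pos w).ne'
  have hτ := tauNegOne_param hw hq
  unfold C4 C5
  rw [den_param hw hq, tauHat_neg_two, tauHat_neg_one, tauHat_one,
    tauTilde_zero, tauTilde_neg_two, hτ]
  clear hτ
  generalize u w = U at *
  subst hw
  unfold wOf
  field_simp
  unfold quad
  ring

theorem C4_add_C5_inv (hw : w = wOf (u w) z) (hq : quad (u w) z ≠ 0)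
    (_ : 1 - u w ^ 2 ≠ 0) (_ : z ≠ 0) (_ : z - u w ≠ 0) :
    C4 w (u w * z) * (u w / z - u w ^ 2) + u w ^ 2 * C5 w (u w * z)
      = -(tauNegOne w * (1 - u w * z) ^ 4 / (u w ^ 3 * z ^ 2)) := by
  have hu := (u_pos w).ne'
  have hτ := tauNegOne_param hw hq
  unfold C4 C5
  rw [den_param hw hq, tauHat_neg_two, tauHat_neg_one, tauHat_one,
    tauTilde_zero, tauTilde_neg_two, hτ]
  clear hτ
  generalize u w = U at *
  subst hw
  unfold wOf
  field_simp
  unfold quad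
  ring

end Parametrization

/-! ### Closed forms of the four approximations in terms of u and γ. -/

/-- `γ` is the small root of the characteristic equation `τ₋₁ (γ² + 1) + mid γ = 0`, so that
`α₁ = u / γ` and `α₂ = u γ`. -/
structure IsRoot (w γ : ℝ) : Prop where
  w_pos : 0 < w
  neg_one_lt : -1 < γ
  neg : γ < 0
  sq_le : γ ^ 2 ≤ rate
  alpha1_eq : alpha1 w = u w * γ⁻¹
  alpha2_eq : alpha2 w = u w * γ
  char_eq : tauNegOne w * (γ ^ 2 + 1) + mid w * γ = 0
  w_eq : w = wOf (u w) γ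

theorem exists_isRoot {w : ℝ} (hw : 0 < w) : ∃ γ, IsRoot w γ := by
  obtain ⟨γ, h1, h2, h3, h4, h5, h6, h7⟩ := exists_root hw
  exact ⟨γ, hw, h1, h2, h3, by rw [h4, div_eq_mul_inv], h5, h6, h7⟩

/-- The squared reflection coefficient at the boundary. -/
noncomputable def refl (U γ : ℝ) : ℝ := ((γ - U) / (1 - U * γ)) ^ 2

/-- The amplitude of the geometrically decaying part of the inverse. -/
noncomputable def amp (U γ t : ℝ) : ℝ :=
  (1 - U * γ) ^ 2 * (γ - U) ^ 2 / (γ * t * (γ ^ 2 - 1))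

/-- The local correction on the diagonal of the inverse. -/
noncomputable def corr (U γ t : ℝ) : ℝ := (U ^ 2 * (γ ^ 2 + 1) / γ - 2 * U * (1 + U ^ 2)) / t

/-- The decaying profile at gap `d`, with left margin `p` and right margin `q`. -/
noncomputable def bulk (s γ : ℝ) (p d q : ℕ) : ℝ :=
  γ ^ d * (1 - s * γ ^ (2 * p)) * (1 - s * γ ^ (2 * q))

theorem quad_inv (U : ℝ) {z : ℝ} (hz : z ≠ 0) : quad U z⁻¹ = quad U z / z ^ 2 := by
  unfold quad; field_simp; ring

/-- The characteristic equation is palindromic, so both roots yield the same w. This lets every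
parametrized identity be used at α₁ as well as α₂. -/
theorem wOf_inv (U : ℝ) {z : ℝ} (hz : z ≠ 0) : wOf U z⁻¹ = wOf U z := by
  unfold wOf
  rw [quad_inv U hz]
  by_cases hU : U = 0
  · simp [hU]
  by_cases hq : quad U z = 0
  · simp [hq]
  field_simp
  ring

namespace IsRoot

variable {w γ : ℝ}

theorem ne_zero (h : IsRoot w γ) : γ ≠ 0 := h.neg.ne

theorem u_lt_one (h : IsRoot w γ) : u w < 1 := MaternInverse.u_lt_one h.w_pos

theorem one_sub_sq_pos (h : IsRoot w γ) : 0 < 1 - u w ^ 2 := by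
  nlinarith [u_pos w, h.u_lt_one]

theorem one_sub_mul_pos (h : IsRoot w γ) : 0 < 1 - u w * γ := by
  nlinarith [mul_pos (u_pos w) (neg_pos.2 h.neg)]

theorem sub_neg (h : IsRoot w γ) : γ - u w < 0 := by linarith [u_pos w, h.neg]

theorem sq_lt_one (h : IsRoot w γ) : γ ^ 2 < 1 := by nlinarith [h.neg, h.neg_one_lt]

theorem quad_ne (h : IsRoot w γ) : quad (u w) γ ≠ 0 := (quad_pos (u_pos w) h.neg).ne'

theorem quad_inv_ne (h : IsRoot w γ) : quad (u w) γ⁻¹ ≠ 0 :=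
  (quad_pos (u_pos w) (inv_lt_zero.2 h.neg)).ne'

theorem inv_sub_ne (h : IsRoot w γ) : γ⁻¹ - u w ≠ 0 := by
  have := inv_lt_zero.2 h.neg
  have := u_pos w
  linarith

theorem w_eq_inv (h : IsRoot w γ) : w = wOf (u w) γ⁻¹ := by
  rw [wOf_inv _ h.ne_zero]; exact h.w_eq

theorem tau_pos (h : IsRoot w γ) : 0 < tauNegOne w := tauNegOne_pos h.w_pos

theorem mid_eq (h : IsRoot w γ) : mid w = -(tauNegOne w * (γ ^ 2 + 1)) / γ := by
  rw [eq_div_iff h.ne_zero]; linear_combination h.char_eq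

/-- Passing from γ to γ⁻¹ exchanges the factors `γ - u` and `1 - u γ` up to powers of γ, so the
quotient is a reflection coefficient. -/
theorem edge_ratio (h : IsRoot w γ) :
    edge w (alpha2 w) / edge w (alpha1 w) = γ ^ 2 * refl (u w) γ ^ 2 := by
  have hq := h.quad_ne
  have h0 := h.ne_zero
  have hu := (u_pos w).ne'
  have h1 := h.one_sub_sq_pos.ne'
  have h2 := h.one_sub_mul_pos.ne'
  rw [h.alpha1_eq, h.alpha2_eq, edge_param h.w_eq hq, edge_param h.w_eq_inv h.quad_inv_ne,
    quad_inv _ h0, refl, show γ⁻¹ - u w = (1 - u w * γ) / γ by field_simp]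
  field_simp

theorem alpha_div (h : IsRoot w γ) : alpha2 w / alpha1 w = γ ^ 2 := by
  have h0 := h.ne_zero
  have hu := (u_pos w).ne'
  rw [h.alpha1_eq, h.alpha2_eq]
  field_simp

theorem alpha_sub (h : IsRoot w γ) : alpha1 w - alpha2 w = u w * (1 - γ ^ 2) / γ := by
  have h0 := h.ne_zero
  rw [h.alpha1_eq, h.alpha2_eq]
  field_simp

theorem lead_mul_alpha1 (h : IsRoot w γ) : -lead w * alpha1 w = -(tauNegOne w * γ⁻¹) := by
  have hu := (u_pos w).ne'
  rw [h.alpha1_eq, lead_eq]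
  field_simp

theorem lead_mul_alpha2 (h : IsRoot w γ) : -lead w * alpha2 w = -(tauNegOne w * γ) := by
  have hu := (u_pos w).ne'
  rw [h.alpha2_eq, lead_eq]
  field_simp

end IsRoot

/-- Isolates the combinations `c (x - U²) + U² k`, the only ones with short closed forms. -/
theorem near_diagonal_regroup (c c' k k' t U x y e e' M M' r s p : ℝ) :
    c * t * U ^ 4 / (x - y) * ((x - U ^ 2) / M - (y - U ^ 2) / M * r)
      - c' * t * U ^ 4 * e / ((x - y) * e') * ((x - U ^ 2) / M' * s - (y - U ^ 2) / M' * p)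
      + k * t * U ^ 6 / (x - y) * (1 / M - 1 / M * r)
      - k' * t * U ^ 6 * e / ((x - y) * e') * (1 / M' * s - 1 / M' * p)
    = t * U ^ 4 / (x - y) * (((c * (x - U ^ 2) + U ^ 2 * k) - (c * (y - U ^ 2) + U ^ 2 * k) * r) / M
      - e / e' * ((c' * (x - U ^ 2) + U ^ 2 * k') * s - (c' * (y - U ^ 2) + U ^ 2 * k') * p) / M') := by
  simp only [div_mul_eq_div_div]
  ring

theorem diagApprox_eq {w γ : ℝ} (h : IsRoot w γ) (p q : ℕ) :
    diagApprox w (p + 1 + (q + 2)) (p + 1)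
      = amp (u w) γ (tauNegOne w) * bulk (refl (u w) γ) γ p 0 (q + 2)
        + corr (u w) γ (tauNegOne w) * (1 - refl (u w) γ ^ 2 * γ ^ (2 * (p + q + 2))) := by
  have h0 := h.ne_zero
  have hu := (u_pos w).ne'
  have h1 := h.one_sub_sq_pos.ne'
  have h2 := h.one_sub_mul_pos.ne'
  have h3 : 1 - γ ^ 2 ≠ 0 := (sub_pos.2 h.sq_lt_one).ne'
  have h3' : γ ^ 2 - 1 ≠ 0 := (sub_neg.2 h.sq_lt_one).ne
  have hτ := h.tau_pos.ne'
  have e1 := C1_add_C2_self h.w_eq h.quad_ne h1 h0 h.sub_neg.ne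
  have e2 := C1_add_C2_inv h.w_eq h.quad_ne h1 h0 h.sub_neg.ne
  have e3 := C1_add_C2_self h.w_eq_inv h.quad_inv_ne h1 (inv_ne_zero h0) h.inv_sub_ne
  have e4 := C1_add_C2_inv h.w_eq_inv h.quad_inv_ne h1 (inv_ne_zero h0) h.inv_sub_ne
  rw [div_inv_eq_mul, ← h.alpha1_eq, ← h.alpha2_eq] at e4
  rw [div_eq_mul_inv, ← h.alpha1_eq, ← h.alpha2_eq] at e2
  rw [← h.alpha1_eq] at e3
  rw [← h.alpha2_eq] at e1
  unfold diagApprox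
  rw [near_diagonal_regroup, h.edge_ratio, h.alpha_div, h.lead_mul_alpha1, h.lead_mul_alpha2,
    h.alpha_sub, e1, e2, e3, e4, h.mid_eq, h.alpha1_eq, h.alpha2_eq,
    show p + 1 + (q + 2) - (p + 1) - 2 = q by omega, show p + 1 + (q + 2) - 2 = p + 1 + q by omega,
    bulk, amp, corr, refl]
  simp only [mul_add, pow_add, pow_mul, pow_one]
  clear e1 e2 e3 e4
  generalize (γ ^ 2) ^ p = P
  generalize (γ ^ 2) ^ q = Q
  generalize u w = U at *
  generalize tauNegOne w = t at *
  rw [show γ⁻¹ - U = (1 - U * γ) / γ by field_simp, show 1 - U * γ⁻¹ = (γ - U) / γ by field_simp,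
    show γ⁻¹ ^ 2 - 1 = (1 - γ ^ 2) / γ ^ 2 by field_simp]
  field_simp
  ring

theorem superdiagApprox_eq {w γ : ℝ} (h : IsRoot w γ) (p q : ℕ) :
    superdiagApprox w (p + 1 + (q + 2)) (p + 1)
      = amp (u w) γ (tauNegOne w) * bulk (refl (u w) γ) γ p 1 (q + 1)
        + u w ^ 2 / tauNegOne w * (1 - refl (u w) γ ^ 2 * γ ^ (2 * (p + q + 2))) := by
  have h0 := h.ne_zero
  have hu := (u_pos w).ne'
  have h1 := h.one_sub_sq_pos.ne'
  have h2 := h.one_sub_mul_pos.ne'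
  have h3 : 1 - γ ^ 2 ≠ 0 := (sub_pos.2 h.sq_lt_one).ne'
  have h3' : γ ^ 2 - 1 ≠ 0 := (sub_neg.2 h.sq_lt_one).ne
  have hτ := h.tau_pos.ne'
  have e1 := C4_add_C5_self h.w_eq h.quad_ne h1 h0 h.sub_neg.ne
  have e2 := C4_add_C5_inv h.w_eq h.quad_ne h1 h0 h.sub_neg.ne
  have e3 := C4_add_C5_self h.w_eq_inv h.quad_inv_ne h1 (inv_ne_zero h0) h.inv_sub_ne
  have e4 := C4_add_C5_inv h.w_eq_inv h.quad_inv_ne h1 (inv_ne_zero h0) h.inv_sub_ne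
  rw [div_inv_eq_mul, ← h.alpha1_eq, ← h.alpha2_eq] at e4
  rw [div_eq_mul_inv, ← h.alpha1_eq, ← h.alpha2_eq] at e2
  rw [← h.alpha1_eq] at e3
  rw [← h.alpha2_eq] at e1
  unfold superdiagApprox
  rw [near_diagonal_regroup, h.edge_ratio, h.alpha_div, h.lead_mul_alpha1, h.lead_mul_alpha2,
    h.alpha_sub, e1, e2, e3, e4, h.alpha1_eq, h.alpha2_eq,
    show p + 1 + (q + 2) - (p + 1) - 2 = q by omega, show p + 1 + (q + 2) - 2 = p + 1 + q by omega,
    bulk, amp, refl]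
  simp only [mul_add, pow_add, pow_mul, pow_one]
  clear e1 e2 e3 e4
  generalize (γ ^ 2) ^ p = P
  generalize (γ ^ 2) ^ q = Q
  generalize u w = U at *
  generalize tauNegOne w = t at *
  rw [show γ⁻¹ - U = (1 - U * γ) / γ by field_simp, show 1 - U * γ⁻¹ = (γ - U) / γ by field_simp,
    show γ⁻¹ ^ 2 - 1 = (1 - γ ^ 2) / γ ^ 2 by field_simp]
  field_simp
  ring

theorem C6_eq {w z : ℝ} (hw : w = wOf (u w) z) (hq : quad (u w) z ≠ 0)
    (h1 : 1 - u w ^ 2 ≠ 0) (hz : z ≠ 0) (hzu : z - u w ≠ 0) :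
    C6 w (u w * z) = tauNegOne w ^ 2 * (1 - u w * z) ^ 2 := by
  rw [C6_param hw hq h1 hz hzu, tauNegOne_param hw hq]
  field_simp

theorem offdiagApprox_eq {w γ : ℝ} (h : IsRoot w γ) (p d q : ℕ) :
    offdiagApprox w (p + 3 + (d + 2) + (q + 1)) (p + 3) (p + 3 + (d + 2))
      = amp (u w) γ (tauNegOne w) * bulk (refl (u w) γ) γ (p + 2) (d + 2) (q + 1) := by
  have h0 := h.ne_zero
  have hu := (u_pos w).ne'
  have h1 := h.one_sub_sq_pos.ne'
  have h2 := h.one_sub_mul_pos.ne'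
  have h3 : 1 - γ ^ 2 ≠ 0 := (sub_pos.2 h.sq_lt_one).ne'
  have h3' : γ ^ 2 - 1 ≠ 0 := (sub_neg.2 h.sq_lt_one).ne
  have h4 := h.sub_neg.ne
  have hτ := h.tau_pos.ne'
  have hq := h.quad_ne
  have ht1 : tail w (alpha1 w) = -tauNegOne w * u w * (1 - u w * γ) ^ 2 / γ ^ 2 := by
    rw [h.alpha1_eq, tail_param h.w_eq_inv h.quad_inv_ne, tauNegOne_param h.w_eq hq,
      quad_inv _ h0]
    field_simp
  have ht2 : tail w (alpha2 w) = -tauNegOne w * u w * (γ - u w) ^ 2 := by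
    rw [h.alpha2_eq, tail_param h.w_eq hq, tauNegOne_param h.w_eq hq]
    field_simp
  have c1 : C6 w (alpha1 w) = tauNegOne w ^ 2 * (1 - u w * γ⁻¹) ^ 2 := by
    rw [h.alpha1_eq, C6_eq h.w_eq_inv h.quad_inv_ne h1 (inv_ne_zero h0) h.inv_sub_ne]
  have c2 : C6 w (alpha2 w) = tauNegOne w ^ 2 * (1 - u w * γ) ^ 2 := by
    rw [h.alpha2_eq, C6_eq h.w_eq h.quad_ne h1 h0 h4]
  have hγ : u w / alpha1 w = γ := by rw [h.alpha1_eq]; field_simp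
  unfold offdiagApprox
  rw [mul_div_assoc (C6 w (alpha2 w)), h.edge_ratio, h.alpha_div, h.alpha_sub, c2, c1, ht1, ht2, hγ,
    show p + 3 + (d + 2) - (p + 3) + 2 = d + 4 by omega,
    show p + 3 + (d + 2) + (q + 1) - (p + 3 + (d + 2)) - 1 = q by omega,
    show p + 3 - 3 = p by omega,
    show p + 3 + (d + 2) + (q + 1) - (p + 3 + (d + 2)) + (p + 3) - 4 = p + q by omega,
    bulk, amp, refl]
  simp only [mul_add, pow_add, pow_mul, pow_one]
  generalize (γ ^ 2) ^ p = P
  generalize (γ ^ 2) ^ q = Q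
  field_simp
  ring

theorem lastColApprox_eq {w γ : ℝ} (h : IsRoot w γ) (p d : ℕ) :
    lastColApprox w (p + 1 + (d + 2)) (p + 1)
      = amp (u w) γ (tauNegOne w) * bulk (refl (u w) γ) γ p (d + 2) 0 / (1 - u w ^ 2) := by
  have h0 := h.ne_zero
  have hu := (u_pos w).ne'
  have h1 := h.one_sub_sq_pos.ne'
  have h2 := h.one_sub_mul_pos.ne'
  have h3' : γ ^ 2 - 1 ≠ 0 := (sub_neg.2 h.sq_lt_one).ne
  have h4 := h.sub_neg.ne
  have hτ := h.tau_pos.ne'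
  have c1 : C6 w (alpha1 w) = tauNegOne w ^ 2 * (1 - u w * γ⁻¹) ^ 2 := by
    rw [h.alpha1_eq, C6_eq h.w_eq_inv h.quad_inv_ne h1 (inv_ne_zero h0) h.inv_sub_ne]
  have c2 : C6 w (alpha2 w) = tauNegOne w ^ 2 * (1 - u w * γ) ^ 2 := by
    rw [h.alpha2_eq, C6_eq h.w_eq h.quad_ne h1 h0 h4]
  have hγ : u w / alpha1 w = γ := by rw [h.alpha1_eq]; field_simp
  unfold lastColApprox
  rw [div_mul_eq_div_div, mul_div_assoc (C6 w (alpha2 w)), h.edge_ratio, h.alpha_div,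
    h.lead_mul_alpha1, h.lead_mul_alpha2, c2, c1, hγ,
    show p + 1 + (d + 2) - (p + 1) - 2 = d by omega, bulk, amp, refl]
  simp only [mul_zero, pow_zero, pow_add, pow_mul, pow_one]
  generalize (γ ^ 2) ^ p = P
  field_simp
  ring

/-! ### Difference operators that localize the covariance matrix. -/

open Finset

/-- The covariance at lag `m`. -/
noncomputable def cov (w : ℝ) (m : ℕ) : ℝ := (1 + m * w) * u w ^ m

/-- The product of the `n × n` covariance matrix with the vector `y`, at index `k`. -/
noncomputable def conv (w : ℝ) (n : ℕ) (y : ℕ → ℝ) (k : ℕ) : ℝ :=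
  ∑ l ∈ range n, cov w ((k - l) + (l - k)) * y l

theorem conv_reflect (w : ℝ) (n : ℕ) (y : ℕ → ℝ) {k : ℕ} (hk : k < n) :
    conv w n (fun l => y (n - 1 - l)) k = conv w n y (n - 1 - k) := by
  unfold conv
  rw [← sum_range_reflect]
  refine sum_congr rfl fun l hl => ?_
  rw [mem_range] at hl
  dsimp only
  rw [show n - 1 - (n - 1 - l) = l by omega,
    show k - (n - 1 - l) + (n - 1 - l - k) = n - 1 - k - l + (l - (n - 1 - k)) by omega]

/-- The backward second difference annihilating the exponential polynomials `(p + q k) u⁻ᵏ`. -/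
noncomputable def diff (U : ℝ) (g : ℕ → ℝ) (k : ℕ) : ℝ :=
  g k - 2 * U * g (k + 1) + U ^ 2 * g (k + 2)

/-- The symmetric fourth-order difference, centred at `k + 2`. -/
noncomputable def diff4 (U : ℝ) (g : ℕ → ℝ) (k : ℕ) : ℝ :=
  U ^ 2 * g k - 2 * U * (1 + U ^ 2) * g (k + 1) + ((1 + U ^ 2) ^ 2 + 2 * U ^ 2) * g (k + 2)
    - 2 * U * (1 + U ^ 2) * g (k + 3) + U ^ 2 * g (k + 4)

/-- The factorization of the symbol into `(1 - U z)²` and `(z - U)²`. -/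
theorem diff4_eq (U : ℝ) (g : ℕ → ℝ) (k : ℕ) :
    diff4 U g k = diff U g (k + 2) - 2 * U * diff U g (k + 1) + U ^ 2 * diff U g k := by
  unfold diff4 diff; ring_nf

theorem a_eq (w : ℝ) : a w = mid w + 2 * tauNegOne w * u w := by
  linear_combination a_sub_eq_mid w

/-- The second coefficient of the one-sided symbol. -/
noncomputable def side (w : ℝ) : ℝ :=
  tauNegOne w + 2 * u w * mid w + 3 * u w ^ 2 * tauNegOne w

/-- With truncated subtraction, `(k - l) + (l - k)` is `|k - l|`. A stencil lying on one side of l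
sees an exponential polynomial annihilated by one of the two factors; only the three stencils with l
strictly inside survive. -/
theorem diff4_cov (w : ℝ) (k l : ℕ) :
    diff4 (u w) (fun k => cov w ((k - l) + (l - k))) k =
      (if l = k + 1 then tauNegOne w else 0) + (if l = k + 2 then mid w else 0)
        + (if l = k + 3 then tauNegOne w else 0) := by
  unfold diff4 cov
  dsimp only
  rcases Nat.lt_or_ge k l with hl | hl
  · obtain ⟨d, rfl⟩ := Nat.exists_eq_add_of_lt hl
    match d with
    | 0 =>
      simp [show k + 3 - (k + 0 + 1) = 2 by omega, show k + 2 - (k + 0 + 1) = 1 by omega,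
        show k + 4 - (k + 0 + 1) = 3 by omega, tauNegOne]
      ring
    | 1 =>
      simp [show k + 3 - (k + 1 + 1) = 1 by omega, show k + 1 + 1 - (k + 1) = 1 by omega,
        show k + 4 - (k + 1 + 1) = 2 by omega, show k + 1 + 1 - k = 2 by omega,
        show k - (k + 1 + 1) = 0 by omega, mid]
      ring
    | 2 =>
      simp [show k + 2 + 1 - (k + 1) = 2 by omega, show k + 2 + 1 - (k + 2) = 1 by omega,
        show k + 4 - (k + 2 + 1) = 1 by omega, show k + 2 + 1 - k = 3 by omega,
        show k - (k + 2 + 1) = 0 by omega, tauNegOne]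
      ring
    | d + 3 =>
      rw [show k - (k + (d + 3) + 1) + (k + (d + 3) + 1 - k) = d + 4 by omega,
        show k + 1 - (k + (d + 3) + 1) + (k + (d + 3) + 1 - (k + 1)) = d + 3 by omega,
        show k + 2 - (k + (d + 3) + 1) + (k + (d + 3) + 1 - (k + 2)) = d + 2 by omega,
        show k + 3 - (k + (d + 3) + 1) + (k + (d + 3) + 1 - (k + 3)) = d + 1 by omega,
        show k + 4 - (k + (d + 3) + 1) + (k + (d + 3) + 1 - (k + 4)) = d by omega,
        if_neg (by omega), if_neg (by omega), if_neg (by omega)]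
      push_cast
      ring
  · obtain ⟨d, rfl⟩ := Nat.exists_eq_add_of_le hl
    rw [show l + d - l + (l - (l + d)) = d by omega,
      show l + d + 1 - l + (l - (l + d + 1)) = d + 1 by omega,
      show l + d + 2 - l + (l - (l + d + 2)) = d + 2 by omega,
      show l + d + 3 - l + (l - (l + d + 3)) = d + 3 by omega,
      show l + d + 4 - l + (l - (l + d + 4)) = d + 4 by omega,
      if_neg (by omega), if_neg (by omega), if_neg (by omega)]
    push_cast
    ring

/-- At the left end only the factor annihilating lags `l - k` is available, so the columns near the
end keep defects, here `a` and `τ₋₁`. -/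
theorem diff_cov_zero (w : ℝ) (l : ℕ) :
    diff (u w) (fun k => cov w ((k - l) + (l - k))) 0 =
      (if l = 0 then a w else 0) + (if l = 1 then tauNegOne w else 0) := by
  unfold diff cov
  dsimp only
  match l with
  | 0 => simp [a]; ring
  | 1 => simp [tauNegOne]; ring
  | l + 2 =>
    rw [show 0 - (l + 2) + (l + 2 - 0) = l + 2 by omega,
      show 0 + 1 - (l + 2) + (l + 2 - (0 + 1)) = l + 1 by omega,
      show 0 + 2 - (l + 2) + (l + 2 - (0 + 2)) = l by omega,
      if_neg (by omega), if_neg (by omega)]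
    push_cast
    ring

theorem diff_cov_one (w : ℝ) (l : ℕ) :
    diff (u w) (fun k => cov w ((k - l) + (l - k))) 1 =
      (if l = 0 then side w else 0) + (if l = 1 then a w else 0)
        + (if l = 2 then tauNegOne w else 0) := by
  unfold diff cov
  dsimp only
  match l with
  | 0 => simp [side, mid, tauNegOne]; ring
  | 1 => simp [a]; ring
  | 2 => simp [tauNegOne]; ring
  | l + 3 =>
    rw [show 1 - (l + 3) + (l + 3 - 1) = l + 2 by omega,
      show 1 + 1 - (l + 3) + (l + 3 - (1 + 1)) = l + 1 by omega,
      show 1 + 2 - (l + 3) + (l + 3 - (1 + 2)) = l by omega,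
      if_neg (by omega), if_neg (by omega), if_neg (by omega)]
    push_cast
    ring

theorem diff4_conv (w : ℝ) (n : ℕ) (y : ℕ → ℝ) (k : ℕ) (hk : k + 3 < n) :
    diff4 (u w) (conv w n y) k
      = tauNegOne w * y (k + 1) + mid w * y (k + 2) + tauNegOne w * y (k + 3) := by
  have h : diff4 (u w) (conv w n y) k
      = ∑ l ∈ range n, diff4 (u w) (fun k => cov w ((k - l) + (l - k))) k * y l := by
    simp only [diff4, conv, mul_sum, ← sum_add_distrib, ← sum_sub_distrib]
    exact sum_congr rfl fun l _ => by ring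
  rw [h]
  simp only [diff4_cov, add_mul, ite_mul, zero_mul, sum_add_distrib, sum_ite_eq', mem_range]
  rw [if_pos (by omega), if_pos (by omega), if_pos hk]

theorem diff_conv_zero (w : ℝ) (n : ℕ) (y : ℕ → ℝ) (hn : 1 < n) :
    diff (u w) (conv w n y) 0 = a w * y 0 + tauNegOne w * y 1 := by
  have h : diff (u w) (conv w n y) 0
      = ∑ l ∈ range n, diff (u w) (fun k => cov w ((k - l) + (l - k))) 0 * y l := by
    simp only [diff, conv, mul_sum, ← sum_add_distrib, ← sum_sub_distrib]
    exact sum_congr rfl fun l _ => by ring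
  rw [h]
  simp only [diff_cov_zero, add_mul, ite_mul, zero_mul, sum_add_distrib, sum_ite_eq', mem_range]
  rw [if_pos (by omega), if_pos (by omega)]

theorem diff_conv_one (w : ℝ) (n : ℕ) (y : ℕ → ℝ) (hn : 2 < n) :
    diff (u w) (conv w n y) 1 = side w * y 0 + a w * y 1 + tauNegOne w * y 2 := by
  have h : diff (u w) (conv w n y) 1
      = ∑ l ∈ range n, diff (u w) (fun k => cov w ((k - l) + (l - k))) 1 * y l := by
    simp only [diff, conv, mul_sum, ← sum_add_distrib, ← sum_sub_distrib]
    exact sum_congr rfl fun l _ => by ring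
  rw [h]
  simp only [diff_cov_one, add_mul, ite_mul, zero_mul, sum_add_distrib, sum_ite_eq', mem_range]
  rw [if_pos (by omega), if_pos (by omega), if_pos (by omega)]

/-- A vector annihilated by the fourth-order difference and by the boundary differences at both
ends vanishes. -/
theorem eq_zero_of_diff {U : ℝ} (hU : 0 < U) (hU1 : U < 1) {m : ℕ} {g : ℕ → ℝ}
    (h4 : ∀ k ≤ m, diff4 U g k = 0) (h0 : diff U g 0 = 0) (h1 : diff U g 1 = 0)
    (h0' : g (m + 4) - 2 * U * g (m + 3) + U ^ 2 * g (m + 2) = 0)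
    (h1' : g (m + 3) - 2 * U * g (m + 2) + U ^ 2 * g (m + 1) = 0) :
    ∀ k ≤ m + 4, g k = 0 := by
  -- `diff4` is a second-order recurrence for `diff U g`, so its two zero initial values propagate.
  have hd : ∀ k, k ≤ m + 1 → diff U g k = 0 ∧ diff U g (k + 1) = 0 := by
    intro k
    induction k with
    | zero => exact fun _ => ⟨h0, h1⟩
    | succ k ih =>
      intro hk
      obtain ⟨ha, hb⟩ := ih (by omega)
      have := h4 k (by omega)
      rw [diff4_eq, ha, hb] at this
      exact ⟨hb, by linarith⟩
  have e1 := (hd (m + 1) le_rfl).1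
  have e2 := (hd (m + 1) le_rfl).2
  simp only [diff] at e1 e2
  have hsq : 0 < 1 - U ^ 2 := by nlinarith
  -- The last four values satisfy the Sylvester system of `(1 - U z)²` and `(z - U)²`, whose
  -- resultant is `(1 - U²)⁴`.
  have hq : g (m + 3) = 0 := by
    have : (1 - U ^ 2) ^ 4 * g (m + 3) = 0 := by
      simp only [show m + 1 + 1 = m + 2 by omega, show m + 1 + 2 = m + 3 by omega,
        show m + 2 + 2 = m + 4 by omega] at e1 e2
      linear_combination (1 - U ^ 2) * (1 + U ^ 2) * h1' - 2 * U ^ 3 * (1 - U ^ 2) * h0'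
        - (1 - U ^ 2) * (1 + U ^ 2) * U ^ 2 * e1
        + (2 * U * (1 - U ^ 2) * (1 + U ^ 2) + 2 * U ^ 5 * (1 - U ^ 2)
          - 2 * U ^ 3 * (1 - U ^ 2) * (1 + U ^ 2)) * e2
    exact (mul_eq_zero.1 this).resolve_left (by positivity)
  have hp : g (m + 4) = 0 := by
    have : (1 - U ^ 4) * g (m + 4) = 0 := by
      simp only [show m + 1 + 1 + 2 = m + 4 by omega, show m + 1 + 1 + 1 = m + 3 by omega,
        show m + 1 + 1 = m + 2 by omega, hq] at e2 h0'
      linear_combination h0' - U ^ 2 * e2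
    refine (mul_eq_zero.1 this).resolve_left ?_
    have : 0 < (1 - U ^ 2) * (1 + U ^ 2) := by positivity
    nlinarith
  -- `diff U g k = 0` determines `g k` from the next two values, so the zeros spread downwards.
  have hall : ∀ j, j ≤ m + 3 → g (m + 4 - j) = 0 ∧ g (m + 4 - (j + 1)) = 0 := by
    intro j
    induction j with
    | zero => exact fun _ => ⟨hp, hq⟩
    | succ j ih =>
      intro hj
      obtain ⟨ha, hb⟩ := ih (by omega)
      refine ⟨hb, ?_⟩
      have hk : m + 4 - (j + 1 + 1) ≤ m + 2 := by omega
      have hz : diff U g (m + 4 - (j + 1 + 1)) = 0 := by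
        rcases Nat.lt_or_ge (m + 4 - (j + 1 + 1)) (m + 2) with hlt | hge
        · exact (hd _ (by omega)).1
        · rw [show m + 4 - (j + 1 + 1) = m + 1 + 1 by omega]
          exact (hd (m + 1) le_rfl).2
      rw [diff, show m + 4 - (j + 1 + 1) + 1 = m + 4 - (j + 1) by omega,
        show m + 4 - (j + 1 + 1) + 2 = m + 4 - j by omega, ha, hb] at hz
      linarith
  intro k hk
  rcases Nat.eq_zero_or_pos k with rfl | hk0
  · have := (hall (m + 3) le_rfl).2
    simpa using this
  · have := (hall (m + 4 - k) (by omega)).1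
    rwa [show m + 4 - (m + 4 - k) = k by omega] at this

/-- A vector whose local equations agree with those of `e` is mapped to `e` by the covariance
matrix. -/
theorem conv_eq_of_local {w : ℝ} (hw : 0 < w) {m : ℕ} {y e : ℕ → ℝ}
    (h4 : ∀ k ≤ m, tauNegOne w * y (k + 1) + mid w * y (k + 2) + tauNegOne w * y (k + 3)
      = diff4 (u w) e k)
    (h0 : a w * y 0 + tauNegOne w * y 1 = diff (u w) e 0)
    (h1 : side w * y 0 + a w * y 1 + tauNegOne w * y 2 = diff (u w) e 1)
    (h0' : a w * y (m + 4) + tauNegOne w * y (m + 3) = diff (u w) (fun k => e (m + 4 - k)) 0)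
    (h1' : side w * y (m + 4) + a w * y (m + 3) + tauNegOne w * y (m + 2)
      = diff (u w) (fun k => e (m + 4 - k)) 1) :
    ∀ k ≤ m + 4, conv w (m + 5) y k = e k := by
  have key := eq_zero_of_diff (u_pos w) (u_lt_one hw) (m := m)
    (g := fun k => conv w (m + 5) y k - e k) ?_ ?_ ?_ ?_ ?_
  · exact fun k hk => sub_eq_zero.1 (key k hk)
  · intro k hk
    have := diff4_conv w (m + 5) y k (by omega)
    rw [h4 k hk] at this
    unfold diff4 at this ⊢
    linear_combination this
  · have := diff_conv_zero w (m + 5) y (by omega)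
    rw [h0] at this
    unfold diff at this ⊢
    linear_combination this
  · have := diff_conv_one w (m + 5) y (by omega)
    rw [h1] at this
    unfold diff at this ⊢
    linear_combination this
  · have := diff_conv_zero w (m + 5) (fun l => y (m + 5 - 1 - l)) (by omega)
    simp only [show m + 5 - 1 - 0 = m + 4 by omega, show m + 5 - 1 - 1 = m + 3 by omega] at this
    rw [h0'] at this
    unfold diff at this
    rw [conv_reflect _ _ _ (by omega), conv_reflect _ _ _ (by omega),
      conv_reflect _ _ _ (by omega)] at this
    simp only [show m + 5 - 1 - 0 = m + 4 by omega, show m + 5 - 1 - (0 + 1) = m + 3 by omega,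
      show m + 5 - 1 - (0 + 2) = m + 2 by omega, show m + 4 - 0 = m + 4 by omega,
      show m + 4 - (0 + 1) = m + 3 by omega, show m + 4 - (0 + 2) = m + 2 by omega] at this
    linear_combination this
  · have := diff_conv_one w (m + 5) (fun l => y (m + 5 - 1 - l)) (by omega)
    simp only [show m + 5 - 1 - 0 = m + 4 by omega, show m + 5 - 1 - 1 = m + 3 by omega,
      show m + 5 - 1 - 2 = m + 2 by omega] at this
    rw [h1'] at this
    unfold diff at this
    rw [conv_reflect _ _ _ (by omega), conv_reflect _ _ _ (by omega),
      conv_reflect _ _ _ (by omega)] at this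
    simp only [show m + 5 - 1 - 1 = m + 3 by omega, show m + 5 - 1 - (1 + 1) = m + 2 by omega,
      show m + 5 - 1 - (1 + 2) = m + 1 by omega, show m + 4 - 1 = m + 3 by omega,
      show m + 4 - (1 + 1) = m + 2 by omega, show m + 4 - (1 + 2) = m + 1 by omega] at this
    linear_combination this

/-! ### Exact interior rows of the inverse. -/

/-- The exact entries of the inverse of the `(N + 1) × (N + 1)` matrix are the approximations divided
by `1 - kappa w γ N`. -/
noncomputable def kappa (w γ : ℝ) (N : ℕ) : ℝ := refl (u w) γ ^ 2 * γ ^ (2 * N)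

/-- The row of the inverse with `p` entries to the left and `q` entries to the right of the
diagonal. -/
noncomputable def row (w γ : ℝ) (p q k : ℕ) : ℝ :=
  amp (u w) γ (tauNegOne w) / (1 - kappa w γ (p + q)) *
      (if k ≤ p then bulk (refl (u w) γ) γ k (p - k) q
        else bulk (refl (u w) γ) γ p (k - p) (p + q - k)) *
      (if k = 0 ∨ k = p + q then (1 - u w ^ 2)⁻¹ else 1)
    + (if k = p then corr (u w) γ (tauNegOne w)
        else if k + 1 = p ∨ k = p + 1 then u w ^ 2 / tauNegOne w else 0)

theorem bulk_comm (s γ : ℝ) (p d q : ℕ) : bulk s γ p d q = bulk s γ q d p := by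
  unfold bulk; ring

/-- Reversal symmetry, which reduces the equations to the diagonal position and what lies to its
left. -/
theorem row_reflect (w γ : ℝ) (p q : ℕ) {k : ℕ} (hk : k ≤ p + q) :
    row w γ p q (p + q - k) = row w γ q p k := by
  unfold row
  have e1 : (if p + q - k ≤ p then bulk (refl (u w) γ) γ (p + q - k) (p - (p + q - k)) q
        else bulk (refl (u w) γ) γ p (p + q - k - p) (p + q - (p + q - k)))
      = if k ≤ q then bulk (refl (u w) γ) γ k (q - k) p
        else bulk (refl (u w) γ) γ q (k - q) (q + p - k) := by
    rw [show p + q - (p + q - k) = k by omega, show p - (p + q - k) = k - q by omega,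
      show p + q - k - p = q - k by omega, add_comm q p]
    rcases lt_trichotomy k q with h | h | h
    · rw [if_neg (by omega), if_pos h.le, bulk_comm]
    · subst h
      rw [if_pos (by omega), if_pos le_rfl, bulk_comm, Nat.sub_self, Nat.add_sub_cancel]
    · rw [if_pos (by omega), if_neg (by omega), bulk_comm]
  rw [e1, add_comm q p]
  simp only [show (p + q - k = 0 ∨ p + q - k = p + q) ↔ (k = 0 ∨ k = p + q) by omega,
    show p + q - k = p ↔ k = q by omega,
    show (p + q - k + 1 = p ∨ p + q - k = p + 1) ↔ (k + 1 = q ∨ k = q + 1) by omega]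

section Equations

variable {w γ : ℝ}

theorem bulk_recurrence (h : IsRoot w γ) (s : ℝ) (k d q : ℕ) :
    tauNegOne w * bulk s γ (k + 1) (d + 2) q + mid w * bulk s γ (k + 2) (d + 1) q
      + tauNegOne w * bulk s γ (k + 3) d q = 0 := by
  have h0 := h.ne_zero
  rw [h.mid_eq]
  unfold bulk
  field_simp
  ring

/-- The jump of the Green's function at its source. The last factor, equal to `1 - kappa`, comes
from the Wronskian of the solutions adapted to the two ends. -/
theorem bulk_recurrence_center (h : IsRoot w γ) (s : ℝ) (p q : ℕ) :
    tauNegOne w * bulk s γ p 1 (q + 1) + mid w * bulk s γ (p + 1) 0 (q + 1)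
      + tauNegOne w * bulk s γ (p + 1) 1 q
      = tauNegOne w * (γ - γ⁻¹) * (1 - s ^ 2 * γ ^ (2 * (p + 1 + (q + 1)))) := by
  have h0 := h.ne_zero
  rw [h.mid_eq]
  unfold bulk
  field_simp
  ring

theorem amp_mul (h : IsRoot w γ) :
    amp (u w) γ (tauNegOne w) * (tauNegOne w * (γ - γ⁻¹))
      = (1 - u w * γ) ^ 2 * (γ - u w) ^ 2 / γ ^ 2 := by
  have h0 := h.ne_zero
  have h3 : γ ^ 2 - 1 ≠ 0 := (sub_neg.2 h.sq_lt_one).ne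
  have hτ := h.tau_pos.ne'
  unfold amp
  field_simp

/-- Together with `bulk_boundary_one` this explains the value of `refl` and the factor `(1 - u²)⁻¹`
on end entries: they make the decaying part satisfy both homogeneous end equations. -/
theorem bulk_boundary_zero (h : IsRoot w γ) (d q : ℕ) :
    a w * (bulk (refl (u w) γ) γ 0 (d + 1) q * (1 - u w ^ 2)⁻¹)
      + tauNegOne w * bulk (refl (u w) γ) γ 1 d q = 0 := by
  have h0 := h.ne_zero
  have h1 := h.one_sub_sq_pos.ne'
  have h2 : 1 - γ * u w ≠ 0 := by rw [mul_comm]; exact h.one_sub_mul_pos.ne'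
  rw [a_eq, h.mid_eq]
  unfold bulk
  generalize 1 - refl (u w) γ * γ ^ (2 * q) = Q
  simp only [refl, mul_zero, pow_zero, mul_one]
  field_simp
  ring

theorem bulk_boundary_one (h : IsRoot w γ) (d q : ℕ) :
    side w * (bulk (refl (u w) γ) γ 0 (d + 2) q * (1 - u w ^ 2)⁻¹)
      + a w * bulk (refl (u w) γ) γ 1 (d + 1) q
      + tauNegOne w * bulk (refl (u w) γ) γ 2 d q = 0 := by
  have h0 := h.ne_zero
  have h1 := h.one_sub_sq_pos.ne'
  have h2 := h.one_sub_mul_pos.ne'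
  rw [side, a_eq, h.mid_eq]
  unfold bulk
  generalize 1 - refl (u w) γ * γ ^ (2 * q) = Q
  simp only [refl, mul_zero, pow_zero, mul_one]
  field_simp
  ring

/-- The neighbour correction `u² / τ₋₁` accounts for the outer coefficients of D; `corr` is chosen
so that the next ones, `-2u(1 + u²)`, come out too. -/
theorem mid_mul_corr (h : IsRoot w γ) :
    mid w * (u w ^ 2 / tauNegOne w) + tauNegOne w * corr (u w) γ (tauNegOne w)
      = -(2 * u w * (1 + u w ^ 2)) := by
  have h0 := h.ne_zero
  have hτ := h.tau_pos.ne'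
  rw [h.mid_eq, corr]
  field_simp
  ring

/-- At the centre the local part misses the coefficient of D by the division remainder, the symbol
of D at γ over γ². By `amp_mul`, `amp` supplies exactly this amount. -/
theorem mid_mul_corr_center (h : IsRoot w γ) :
    2 * u w ^ 2 + mid w * corr (u w) γ (tauNegOne w)
      = (1 + u w ^ 2) ^ 2 + 2 * u w ^ 2 - (1 - u w * γ) ^ 2 * (γ - u w) ^ 2 / γ ^ 2 := by
  have h0 := h.ne_zero
  have hτ := h.tau_pos.ne'
  rw [h.mid_eq, corr]
  field_simp
  ring

theorem row_left (p q : ℕ) {k : ℕ} (h0 : k ≠ 0) (hk : k ≤ p) (hq : 0 < q) :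
    row w γ p q k = amp (u w) γ (tauNegOne w) / (1 - kappa w γ (p + q)) *
      bulk (refl (u w) γ) γ k (p - k) q + (if k = p then corr (u w) γ (tauNegOne w)
        else if k + 1 = p then u w ^ 2 / tauNegOne w else 0) := by
  rw [row, if_pos hk, if_neg (by omega : ¬ (k = 0 ∨ k = p + q)), mul_one]
  simp only [show (k + 1 = p ∨ k = p + 1) ↔ k + 1 = p by omega]

theorem row_zero (p q : ℕ) (hp : 2 ≤ p) :
    row w γ p q 0 = amp (u w) γ (tauNegOne w) / (1 - kappa w γ (p + q)) *
      (bulk (refl (u w) γ) γ 0 p q * (1 - u w ^ 2)⁻¹) := by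
  rw [row, if_pos (by omega), if_pos (Or.inl rfl), if_neg (by omega), if_neg (by omega)]
  simp
  ring

theorem row_succ (p q : ℕ) (hq : 2 ≤ q) :
    row w γ p q (p + 1) = amp (u w) γ (tauNegOne w) / (1 - kappa w γ (p + q)) *
      bulk (refl (u w) γ) γ p 1 (q - 1) + u w ^ 2 / tauNegOne w := by
  rw [row, if_neg (by omega), if_neg (by omega), if_neg (by omega), if_pos (Or.inr rfl), mul_one,
    show p + 1 - p = 1 by omega, show p + q - (p + 1) = q - 1 by omega]

theorem row_interior_left (h : IsRoot w γ) (p q k : ℕ) (hq : 2 ≤ q) (hk : k + 2 ≤ p)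
    (hκ : 1 - kappa w γ (p + q) ≠ 0) :
    tauNegOne w * row w γ p q (k + 1) + mid w * row w γ p q (k + 2)
      + tauNegOne w * row w γ p q (k + 3) = diff4 (u w) (fun k => if k = p then 1 else 0) k := by
  have hτ := h.tau_pos.ne'
  have h0 := h.ne_zero
  have e8 : tauNegOne w * (u w ^ 2 / tauNegOne w) = u w ^ 2 := by field_simp
  obtain ⟨d, rfl⟩ := Nat.exists_eq_add_of_le hk
  -- Here d is the distance from the stencil centre `k + 2` to the diagonal p. Both the source and
  -- the local corrections are felt only for d ≤ 2.
  match d with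
  | 0 =>
    have e3 := row_succ (w := w) (γ := γ) (k + 2) q hq
    obtain ⟨q, rfl⟩ : ∃ r, q = r + 1 := ⟨q - 1, by omega⟩
    rw [add_zero, row_left (k + 2) (q + 1) (by omega) (by omega) (by omega),
      row_left (k + 2) (q + 1) (by omega) le_rfl (by omega), e3]
    have e4 := bulk_recurrence_center h (refl (u w) γ) (k + 1) q
    have e5 := amp_mul h
    have e6 : 1 - kappa w γ (k + 2 + (q + 1))
        = 1 - refl (u w) γ ^ 2 * γ ^ (2 * (k + 1 + 1 + (q + 1))) := rfl
    rw [← e6] at e4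
    simp only [diff4, show k + 1 ≠ k + 2 by omega, show k ≠ k + 2 by omega,
      show k + 3 ≠ k + 2 by omega, show k + 4 ≠ k + 2 by omega, if_false, if_true,
      show k + 2 - (k + 1) = 1 by omega, show k + 2 - (k + 2) = 0 by omega,
      show q + 1 - 1 = q by omega]
    have e7 : amp (u w) γ (tauNegOne w) / (1 - kappa w γ (k + 2 + (q + 1)))
        * (tauNegOne w * (γ - γ⁻¹) * (1 - kappa w γ (k + 2 + (q + 1))))
        = (1 - u w * γ) ^ 2 * (γ - u w) ^ 2 / γ ^ 2 := by
      rw [← e5]; field_simp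
    linear_combination amp (u w) γ (tauNegOne w) / (1 - kappa w γ (k + 2 + (q + 1))) * e4 + e7
      + mid_mul_corr_center h + 2 * e8
  | 1 =>
    rw [row_left _ q (by omega) (by omega) (by omega),
      row_left _ q (by omega) (by omega) (by omega),
      row_left _ q (by omega) (by omega) (by omega)]
    have e4 := bulk_recurrence h (refl (u w) γ) k 0 q
    have e5 := mid_mul_corr h
    simp [diff4, show k + 2 + 1 - (k + 1) = 2 by omega, show k + 2 + 1 - (k + 2) = 1 by omega,
      show k ≠ k + 2 + 1 by omega]
    linear_combination amp (u w) γ (tauNegOne w) / (1 - kappa w γ (k + 2 + 1 + q)) * e4 + e5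
  | 2 =>
    rw [row_left _ q (by omega) (by omega) (by omega),
      row_left _ q (by omega) (by omega) (by omega),
      row_left _ q (by omega) (by omega) (by omega)]
    have e4 := bulk_recurrence h (refl (u w) γ) k 1 q
    simp [diff4, show k + 2 + 2 - (k + 1) = 3 by omega, show k + 2 + 2 - (k + 2) = 2 by omega,
      show k + 2 + 2 - (k + 3) = 1 by omega,
      show k ≠ k + 2 + 2 by omega]
    linear_combination amp (u w) γ (tauNegOne w) / (1 - kappa w γ (k + 2 + 2 + q)) * e4 + e8
  | d + 3 =>
    rw [row_left _ q (by omega) (by omega) (by omega),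
      row_left _ q (by omega) (by omega) (by omega),
      row_left _ q (by omega) (by omega) (by omega)]
    have e4 := bulk_recurrence h (refl (u w) γ) k (d + 2) q
    simp only [diff4, show k + 2 + (d + 3) - (k + 1) = d + 2 + 2 by omega,
      show k + 2 + (d + 3) - (k + 2) = d + 2 + 1 by omega,
      show k + 2 + (d + 3) - (k + 3) = d + 2 by omega, show k ≠ k + 2 + (d + 3) by omega,
      show k + 1 ≠ k + 2 + (d + 3) by omega, show k + 2 ≠ k + 2 + (d + 3) by omega,
      show k + 3 ≠ k + 2 + (d + 3) by omega, show k + 4 ≠ k + 2 + (d + 3) by omega,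
      if_false]
    linear_combination amp (u w) γ (tauNegOne w) / (1 - kappa w γ (k + 2 + (d + 3) + q)) * e4

theorem row_interior (h : IsRoot w γ) (p q k : ℕ) (hp : 2 ≤ p) (hq : 2 ≤ q)
    (hk : k + 4 ≤ p + q) (hκ : 1 - kappa w γ (p + q) ≠ 0) :
    tauNegOne w * row w γ p q (k + 1) + mid w * row w γ p q (k + 2)
      + tauNegOne w * row w γ p q (k + 3) = diff4 (u w) (fun k => if k = p then 1 else 0) k := by
  rcases Nat.lt_or_ge p (k + 2) with hlt | hge
  · obtain ⟨m, hm⟩ : ∃ m, m + k + 4 = p + q := ⟨p + q - k - 4, by omega⟩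
    have key := row_interior_left h q p m hp (by omega) (by rwa [add_comm q p])
    rw [← row_reflect w γ p q (by omega), ← row_reflect w γ p q (by omega),
      ← row_reflect w γ p q (by omega), show p + q - (m + 1) = k + 3 by omega,
      show p + q - (m + 2) = k + 2 by omega, show p + q - (m + 3) = k + 1 by omega] at key
    have e : diff4 (u w) (fun k => if k = q then 1 else 0) m
        = diff4 (u w) (fun k => if k = p then 1 else 0) k := by
      simp only [diff4, show m = q ↔ k + 4 = p by omega, show m + 1 = q ↔ k + 3 = p by omega,
        show m + 2 = q ↔ k + 2 = p by omega, show m + 3 = q ↔ k + 1 = p by omega,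
        show m + 4 = q ↔ k = p by omega]
      ring
    rw [← e]
    linear_combination key
  · exact row_interior_left h p q k hq hge hκ

theorem row_boundary_zero (h : IsRoot w γ) (p q : ℕ) (hp : 2 ≤ p) (hq : 2 ≤ q) :
    a w * row w γ p q 0 + tauNegOne w * row w γ p q 1
      = diff (u w) (fun k => if k = p then 1 else 0) 0 := by
  have hτ := h.tau_pos.ne'
  have e8 : tauNegOne w * (u w ^ 2 / tauNegOne w) = u w ^ 2 := by field_simp
  rw [row_zero p q hp, row_left p q one_ne_zero (by omega) (by omega)]
  obtain ⟨d, rfl⟩ := Nat.exists_eq_add_of_le' hp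
  have e := bulk_boundary_zero h (d + 1) q
  simp only [diff, show d + 2 - 1 = d + 1 by omega, show ¬ (1 = d + 2) by omega,
    show ¬ (0 = d + 2) by omega, if_false, show 1 + 1 = d + 2 ↔ d = 0 by omega]
  split_ifs with hd
  · linear_combination amp (u w) γ (tauNegOne w) / (1 - kappa w γ (d + 2 + q)) * e + e8
  · linear_combination amp (u w) γ (tauNegOne w) / (1 - kappa w γ (d + 2 + q)) * e

theorem row_boundary_one (h : IsRoot w γ) (p q : ℕ) (hp : 2 ≤ p) (hq : 2 ≤ q) :
    side w * row w γ p q 0 + a w * row w γ p q 1 + tauNegOne w * row w γ p q 2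
      = diff (u w) (fun k => if k = p then 1 else 0) 1 := by
  have hτ := h.tau_pos.ne'
  have e8 : tauNegOne w * (u w ^ 2 / tauNegOne w) = u w ^ 2 := by field_simp
  have e9 := mid_mul_corr h
  have e10 := a_eq w
  rw [row_zero p q hp, row_left p q one_ne_zero (by omega) (by omega),
    row_left p q two_ne_zero (by omega) (by omega)]
  obtain ⟨d, rfl⟩ := Nat.exists_eq_add_of_le' hp
  have e := bulk_boundary_one h d q
  simp only [diff, show d + 2 - 1 = d + 1 by omega, show ¬ (1 = d + 2) by omega,
    show d + 2 - 2 = d by omega, if_false, show 1 + 1 = d + 2 ↔ d = 0 by omega,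
    show 2 + 1 = d + 2 ↔ d = 1 by omega]
  rcases Nat.eq_zero_or_pos d with rfl | hd
  · simp only [zero_ne_one, if_true, if_false]
    linear_combination amp (u w) γ (tauNegOne w) / (1 - kappa w γ (0 + 2 + q)) * e + e9
      + u w ^ 2 / tauNegOne w * e10 + 2 * u w * e8
  · rw [if_neg hd.ne', if_neg hd.ne', if_neg hd.ne']
    split_ifs with hd1
    · linear_combination amp (u w) γ (tauNegOne w) / (1 - kappa w γ (d + 2 + q)) * e + e8
    · linear_combination amp (u w) γ (tauNegOne w) / (1 - kappa w γ (d + 2 + q)) * e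

theorem conv_row (h : IsRoot w γ) (p q : ℕ) (hp : 2 ≤ p) (hq : 2 ≤ q)
    (hκ : 1 - kappa w γ (p + q) ≠ 0) {k : ℕ} (hk : k ≤ p + q) :
    conv w (p + q + 1) (row w γ p q) k = if k = p then 1 else 0 := by
  obtain ⟨m, hm⟩ : ∃ m, p + q = m + 4 := ⟨p + q - 4, by omega⟩
  have e0 := row_boundary_zero h q p hq hp
  have e1 := row_boundary_one h q p hq hp
  rw [← row_reflect w γ p q (by omega), ← row_reflect w γ p q (by omega)] at e0
  rw [← row_reflect w γ p q (by omega), ← row_reflect w γ p q (by omega),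
    ← row_reflect w γ p q (by omega)] at e1
  rw [hm] at e0 e1
  have hrefl : ∀ j ≤ 3, (if m + 4 - j = p then (1 : ℝ) else 0) = if j = q then 1 else 0 := by
    intro j hj
    simp only [show m + 4 - j = p ↔ j = q by omega]
  rw [hm]
  refine conv_eq_of_local h.w_pos (e := fun k => if k = p then 1 else 0)
    (fun k hk => row_interior h p q k hp hq (by omega) hκ)
    (row_boundary_zero h p q hp hq) (row_boundary_one h p q hp hq) ?_ ?_ k (by omega)
  · simp only [diff] at e0 ⊢
    rw [hrefl 0 (by omega), hrefl (0 + 1) (by omega), hrefl (0 + 2) (by omega)]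
    exact e0
  · simp only [diff] at e1 ⊢
    rw [hrefl 1 (by omega), hrefl (1 + 1) (by omega), hrefl (1 + 2) (by omega)]
    exact e1

end Equations

/-! ### Invertibility and the error bound. -/

theorem R_apply (θ : ℝ) (n : ℕ) (i j : Fin n) :
    R θ n i j = cov (θ / n) (((i : ℕ) - j) + ((j : ℕ) - i)) := by
  have habs : |(i : ℝ) - (j : ℝ)| = (((i : ℕ) - j + ((j : ℕ) - i) : ℕ) : ℝ) := by
    rcases le_total (i : ℕ) (j : ℕ) with hij | hij
    · have h' : (i : ℝ) ≤ j := by exact_mod_cast hij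
      rw [abs_of_nonpos (sub_nonpos.2 h'), Nat.sub_eq_zero_of_le hij, zero_add, Nat.cast_sub hij]
      ring
    · have h' : (j : ℝ) ≤ i := by exact_mod_cast hij
      rw [abs_of_nonneg (sub_nonneg.2 h'), Nat.sub_eq_zero_of_le hij, add_zero, Nat.cast_sub hij]
  rw [R, Matrix.of_apply, habs, cov, u, ← Real.exp_nat_mul]
  congr 1
  · ring
  · congr 1; ring

theorem R_mulVec (θ : ℝ) (n : ℕ) (y : ℕ → ℝ) (k : Fin n) :
    (R θ n).mulVec (fun l => y l) k = conv (θ / n) n y k := by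
  rw [conv, ← Fin.sum_univ_eq_sum_range (fun l => cov (θ / n) ((k - l) + (l - k)) * y l)]
  simp only [Matrix.mulVec, dotProduct, R_apply]

theorem R_transpose (θ : ℝ) (n : ℕ) : (R θ n).transpose = R θ n := by
  ext i j
  rw [Matrix.transpose_apply, R_apply, R_apply, add_comm]

theorem refl_le_one {w γ : ℝ} (h : IsRoot w γ) : refl (u w) γ ≤ 1 := by
  have h2 := h.one_sub_mul_pos
  rw [refl, div_pow, div_le_one (by positivity)]
  nlinarith [mul_pos h.one_sub_sq_pos (sub_pos.2 h.sq_lt_one)]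

theorem kappa_nonneg (w γ : ℝ) (N : ℕ) : 0 ≤ kappa w γ N := by
  unfold kappa
  rw [pow_mul]
  positivity

theorem kappa_le {w γ : ℝ} (h : IsRoot w γ) (N : ℕ) : kappa w γ N ≤ rate ^ N := by
  have h1 := refl_le_one h
  have h0 : 0 ≤ refl (u w) γ := sq_nonneg _
  have h2 : refl (u w) γ ^ 2 ≤ 1 := pow_le_one₀ h0 h1
  rw [kappa, pow_mul]
  calc refl (u w) γ ^ 2 * (γ ^ 2) ^ N ≤ 1 * rate ^ N :=
        mul_le_mul h2 (pow_le_pow_left₀ (sq_nonneg γ) h.sq_le N) (by positivity) zero_le_one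
    _ = rate ^ N := one_mul _

theorem kappa_le_half {w γ : ℝ} (h : IsRoot w γ) {N : ℕ} (hN : 1 ≤ N) : kappa w γ N ≤ 1 / 2 := by
  calc kappa w γ N ≤ rate ^ N := kappa_le h N
    _ ≤ rate ^ 1 := pow_le_pow_of_le_one rate_pos.le (by linarith [rate_lt]) hN
    _ ≤ 1 / 2 := by linarith [rate_lt]

theorem one_sub_kappa_pos {w γ : ℝ} (h : IsRoot w γ) {N : ℕ} (hN : 1 ≤ N) :
    0 < 1 - kappa w γ N := by linarith [kappa_le_half h hN]

/-- The determinant of the system for the two outermost coordinates of a kernel vector. It factors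
as a difference of squares and is positive because `mid > 4 τ₋₁`. -/
theorem a_sq_sub_pos {w : ℝ} (hw : 0 < w) : 0 < a w ^ 2 - side w * tauNegOne w := by
  have hτ := tauNegOne_pos hw
  have hm := four_mul_tauNegOne_lt_mid hw
  have hu := u_pos w
  have e : a w ^ 2 - side w * tauNegOne w
      = (mid w + u w * tauNegOne w) ^ 2 - tauNegOne w ^ 2 := by
    rw [a_eq, side]; ring
  rw [e]
  nlinarith [mul_pos hu hτ]

theorem R_mulVec_row {θ γ : ℝ} {p q : ℕ} (h : IsRoot (θ / (p + q + 1 : ℕ)) γ) (hp : 2 ≤ p)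
    (hq : 2 ≤ q) :
    (R θ (p + q + 1)).mulVec (fun l => row (θ / (p + q + 1 : ℕ)) γ p q l)
      = Pi.single ⟨p, by omega⟩ 1 := by
  ext k
  rw [R_mulVec, conv_row h p q hp hq (one_sub_kappa_pos h (by omega)).ne' (by omega),
    Pi.single_apply]
  simp only [Fin.ext_iff]

theorem eq_zero_of_boundary {w x y : ℝ} (hw : 0 < w) (h0 : a w * x + tauNegOne w * y = 0)
    (h1 : side w * x + a w * y = 0) : x = 0 ∧ y = 0 := by
  have hd := (a_sq_sub_pos hw).ne'
  constructor
  · refine (mul_eq_zero.1 (?_ : (a w ^ 2 - side w * tauNegOne w) * x = 0)).resolve_left hd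
    linear_combination a w * h0 - tauNegOne w * h1
  · refine (mul_eq_zero.1 (?_ : (a w ^ 2 - side w * tauNegOne w) * y = 0)).resolve_left hd
    linear_combination a w * h1 - side w * h0

/-- The interior rows suffice. By symmetry of the matrix, pairing a kernel vector with the preimage
of a unit vector kills each interior coordinate; the end differences then give a nonsingular 2 × 2
system for the two coordinates left at each end. -/
theorem isUnit_det_R {θ : ℝ} (hθ : 0 < θ) {n : ℕ} (hn : 5 ≤ n) : IsUnit (R θ n).det := by
  have hw : 0 < θ / n := div_pos hθ (by exact_mod_cast (by omega : 0 < n))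
  obtain ⟨γ, hγ⟩ := exists_isRoot hw
  rw [isUnit_iff_ne_zero]
  intro hdet
  obtain ⟨v, hv, hv0⟩ := Matrix.exists_mulVec_eq_zero_iff.2 hdet
  apply hv
  set y : ℕ → ℝ := fun k => if hk : k < n then v ⟨k, hk⟩ else 0 with hy
  have hvy : v = fun l : Fin n => y l := by
    ext l; simp [hy]
  have hmid : ∀ p, 2 ≤ p → p + 3 ≤ n → y p = 0 := by
    intro p hp hpn
    obtain ⟨q, rfl⟩ : ∃ q, n = p + q + 1 := ⟨n - p - 1, by omega⟩
    have e := R_mulVec_row hγ hp (by omega)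
    have e2 : v ⬝ᵥ (R θ (p + q + 1)).mulVec (fun l => row (θ / (p + q + 1 : ℕ)) γ p q l) = 0 := by
      rw [Matrix.dotProduct_mulVec, ← Matrix.mulVec_transpose, R_transpose, hv0, zero_dotProduct]
    rw [e, dotProduct_single, mul_one] at e2
    simpa [hy] using e2
  have hconv : ∀ k, k < n → conv (θ / n) n y k = 0 := by
    intro k hk
    have := R_mulVec θ n y ⟨k, hk⟩
    rw [← hvy, hv0] at this
    exact this.symm
  have hleft : y 0 = 0 ∧ y 1 = 0 := by
    have e0 := diff_conv_zero (θ / n) n y (by omega)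
    have e1 := diff_conv_one (θ / n) n y (by omega)
    simp only [diff] at e0 e1
    rw [hconv _ (by omega), hconv _ (by omega), hconv _ (by omega)] at e0 e1
    rw [hmid 2 le_rfl hn] at e1
    exact eq_zero_of_boundary hw (by linarith) (by linarith)
  have hright : y (n - 1) = 0 ∧ y (n - 2) = 0 := by
    have e0 := diff_conv_zero (θ / n) n (fun l => y (n - 1 - l)) (by omega)
    have e1 := diff_conv_one (θ / n) n (fun l => y (n - 1 - l)) (by omega)
    simp only [diff] at e0 e1
    rw [conv_reflect _ _ _ (by omega), conv_reflect _ _ _ (by omega),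
      conv_reflect _ _ _ (by omega), hconv _ (by omega), hconv _ (by omega),
      hconv _ (by omega)] at e0 e1
    rw [hmid (n - 1 - 2) (by omega) (by omega)] at e1
    rw [Nat.sub_zero, show n - 1 - 1 = n - 2 by omega] at e0 e1
    exact eq_zero_of_boundary hw (by linarith) (by linarith)
  ext l
  rw [hvy]
  change y l = 0
  obtain ⟨l, hl⟩ := l
  dsimp only
  rcases (by omega : l = 0 ∨ l = 1 ∨ l = n - 1 ∨ l = n - 2 ∨ (2 ≤ l ∧ l + 3 ≤ n))
    with rfl | rfl | rfl | rfl | ⟨h1, h2⟩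
  exacts [hleft.1, hleft.2, hright.1, hright.2, hmid l h1 h2]

theorem R_inv_apply {θ γ : ℝ} (hθ : 0 < θ) {p q : ℕ} (h : IsRoot (θ / (p + q + 1 : ℕ)) γ)
    (hp : 2 ≤ p) (hq : 2 ≤ q) (k : ℕ) (hk : k < p + q + 1) :
    (R θ (p + q + 1))⁻¹ ⟨p, by omega⟩ ⟨k, hk⟩ = row (θ / (p + q + 1 : ℕ)) γ p q k := by
  have hu := isUnit_det_R hθ (n := p + q + 1) (by omega)
  have e := congrArg ((R θ (p + q + 1))⁻¹.mulVec) (R_mulVec_row h hp hq)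
  rw [Matrix.mulVec_mulVec, Matrix.nonsing_inv_mul _ hu, Matrix.one_mulVec,
    Matrix.mulVec_single_one] at e
  have e1 := congrFun e ⟨k, hk⟩
  rw [e1]
  change _ = (R θ (p + q + 1))⁻¹ ⟨k, hk⟩ ⟨p, by omega⟩
  -- The solved system yields a column of the inverse; symmetry makes it a row.
  conv_rhs => rw [← R_transpose, ← Matrix.transpose_nonsing_inv]
  rfl

/-- The relative error is `ε = κ / (1 - κ)`, at most 2κ when κ ≤ 1/2. -/
theorem relApprox_of_mul_eq {x y κ δ : ℝ} (hκ0 : 0 ≤ κ) (hκ : κ ≤ 1 / 2) (hδ : 2 * κ ≤ δ)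
    (h : x * (1 - κ) = y) : RelApprox x y δ := by
  have hpos : 0 < 1 - κ := by linarith
  refine ⟨κ / (1 - κ), ?_, ?_⟩
  · rw [abs_of_nonneg (by positivity), div_le_iff₀ hpos]
    nlinarith
  · rw [← h]
    field_simp
    ring

end MaternInverse

open MaternInverse in
theorem theorem7 (β₀ β₁ : ℝ) (hβ₀ : 0 < β₀) (hβ : β₀ < β₁) :
    ∃ (K : ℝ) (N : ℕ), ∀ n : ℕ, N ≤ n → ∀ θ ∈ Set.Icc β₀ β₁,
      IsUnit (MaternInverse.R θ n).det ∧
      (∀ (i : ℕ) (_ : 3 ≤ i) (_ : i + 2 ≤ n),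
        MaternInverse.RelApprox
          ((MaternInverse.R θ n)⁻¹ ⟨i - 1, by omega⟩ ⟨i - 1, by omega⟩)
          (MaternInverse.diagApprox (θ / n) n i) (K * MaternInverse.rate ^ n)) ∧
      (∀ (i j : ℕ) (_ : 3 ≤ i) (_ : i + 2 ≤ j) (_ : j + 1 ≤ n),
        MaternInverse.RelApprox
          ((MaternInverse.R θ n)⁻¹ ⟨i - 1, by omega⟩ ⟨j - 1, by omega⟩)
          (MaternInverse.offdiagApprox (θ / n) n i j) (K * MaternInverse.rate ^ n)) ∧
      (∀ (i : ℕ) (_ : 3 ≤ i) (_ : i + 2 ≤ n),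
        MaternInverse.RelApprox
          ((MaternInverse.R θ n)⁻¹ ⟨i - 1, by omega⟩ ⟨(i + 1) - 1, by omega⟩)
          (MaternInverse.superdiagApprox (θ / n) n i) (K * MaternInverse.rate ^ n)) ∧
      (∀ (i : ℕ) (_ : 3 ≤ i) (_ : i + 2 ≤ n),
        MaternInverse.RelApprox
          ((MaternInverse.R θ n)⁻¹ ⟨i - 1, by omega⟩ ⟨n - 1, by omega⟩)
          (MaternInverse.lastColApprox (θ / n) n i) (K * MaternInverse.rate ^ n)) := by
  -- The factor 2 comes from `κ / (1 - κ) ≤ 2κ`, and `1 / rate` from the exponent n - 1 in the bound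
  -- for κ. Invertibility was obtained from n = 5 on.
  refine ⟨2 / rate, 5, fun n hn θ hθ => ?_⟩
  have hθ0 : 0 < θ := hβ₀.trans_le hθ.1
  have hw : 0 < θ / n := div_pos hθ0 (by exact_mod_cast (by omega : 0 < n))
  obtain ⟨γ, hγ⟩ := exists_isRoot hw
  have hδ : 2 * kappa (θ / n) γ (n - 1) ≤ 2 / rate * rate ^ n := by
    have e : 2 / rate * rate ^ n = 2 * rate ^ (n - 1) := by
      obtain ⟨m, rfl⟩ : ∃ m, n = m + 1 := ⟨n - 1, by omega⟩
      have := rate_pos.ne'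
      rw [Nat.add_sub_cancel, pow_succ]
      field_simp
    rw [e]
    linarith [kappa_le hγ (n - 1)]
  have hκ := kappa_le_half hγ (N := n - 1) (by omega)
  have hκ0 := kappa_nonneg (θ / n) γ (n - 1)
  have hpos := (one_sub_kappa_pos hγ (N := n - 1) (by omega)).ne'
  refine ⟨isUnit_det_R hθ0 hn, ?_, ?_, ?_, ?_⟩
  · intro i hi hin
    obtain ⟨p, rfl⟩ : ∃ p, i = p + 1 := ⟨i - 1, by omega⟩
    obtain ⟨q, rfl⟩ : ∃ q, n = p + (q + 2) + 1 := ⟨n - p - 3, by omega⟩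
    refine relApprox_of_mul_eq hκ0 hκ hδ ?_
    have e := diagApprox_eq hγ p q
    rw [show p + 1 + (q + 2) = p + (q + 2) + 1 by omega] at e
    refine (congrArg (· * _) (R_inv_apply hθ0 hγ (by omega) (by omega) p (by omega))).trans ?_
    rw [e, row_left p (q + 2) (by omega) le_rfl (by omega), if_pos rfl, Nat.sub_self]
    simp only [kappa, Nat.add_sub_cancel, ← add_assoc] at hpos ⊢
    field_simp
  · intro i j hi hij hj
    obtain ⟨p, rfl⟩ : ∃ p, i = p + 3 := ⟨i - 3, by omega⟩
    obtain ⟨d, rfl⟩ : ∃ d, j = p + d + 4 + 1 := ⟨j - p - 5, by omega⟩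
    obtain ⟨q, rfl⟩ : ∃ q, n = p + 2 + (d + q + 3) + 1 := ⟨n - p - d - 6, by omega⟩
    refine relApprox_of_mul_eq hκ0 hκ hδ ?_
    have e := offdiagApprox_eq hγ p d q
    rw [show p + 3 + (d + 2) + (q + 1) = p + 2 + (d + q + 3) + 1 by omega,
      show p + 3 + (d + 2) = p + d + 4 + 1 by omega] at e
    refine (congrArg (· * _)
      (R_inv_apply hθ0 hγ (by omega) (by omega) (p + d + 4) (by omega))).trans ?_
    rw [e, row, if_neg (by omega), if_neg (by omega), if_neg (by omega), if_neg (by omega),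
      show p + d + 4 - (p + 2) = d + 2 by omega,
      show p + 2 + (d + q + 3) - (p + d + 4) = q + 1 by omega]
    rw [Nat.add_sub_cancel] at hpos ⊢
    rw [add_zero, mul_one]
    field_simp
  · intro i hi hin
    obtain ⟨p, rfl⟩ : ∃ p, i = p + 1 := ⟨i - 1, by omega⟩
    obtain ⟨q, rfl⟩ : ∃ q, n = p + (q + 2) + 1 := ⟨n - p - 3, by omega⟩
    refine relApprox_of_mul_eq hκ0 hκ hδ ?_
    have e := superdiagApprox_eq hγ p q
    rw [show p + 1 + (q + 2) = p + (q + 2) + 1 by omega] at e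
    refine (congrArg (· * _)
      (R_inv_apply hθ0 hγ (by omega) (by omega) (p + 1) (by omega))).trans ?_
    rw [e, row_succ p (q + 2) (by omega), show q + 2 - 1 = q + 1 by omega]
    simp only [kappa, Nat.add_sub_cancel, ← add_assoc] at hpos ⊢
    field_simp
  · intro i hi hin
    obtain ⟨p, rfl⟩ : ∃ p, i = p + 1 := ⟨i - 1, by omega⟩
    obtain ⟨d, rfl⟩ : ∃ d, n = p + (d + 2) + 1 := ⟨n - p - 3, by omega⟩
    refine relApprox_of_mul_eq hκ0 hκ hδ ?_
    have e := lastColApprox_eq hγ p d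
    rw [show p + 1 + (d + 2) = p + (d + 2) + 1 by omega] at e
    refine (congrArg (· * _)
      (R_inv_apply hθ0 hγ (by omega) (by omega) (p + (d + 2)) (by omega))).trans ?_
    -- The last column is an end entry, hence the factor `(1 - u²)⁻¹`; its distance from the
    -- diagonal is at least 2, so no local correction enters.
    rw [e, row, if_neg (by omega), if_pos (Or.inr rfl), if_neg (by omega), if_neg (by omega),
      Nat.sub_self, show p + (d + 2) - p = d + 2 by omega]
    have h1 := hγ.one_sub_sq_pos.ne'
    rw [Nat.add_sub_cancel] at hpos ⊢
    rw [add_zero]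
    field_simp
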